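/- **Setting.** Let $\mathbb K=\mathbb R$ or $\mathbb C$, let $B,\bar B$ be Banach spaces over $\mathbb K$, and let $G:B\to\bar B$ be analytic near $0$ with $G[0]=0$. For $n\ge1$ and $z_1,\dots,z_n\in B$ put $$T^n[z_1,\dots,z_n]=\frac{d^n}{d\varepsilon^n}\Big|_{\varepsilon=0}G\Big[\varepsilon z_1+\dots+\tfrac1{n!}\varepsilon^nz_n\Big],$$ let $X_n$ be the set of $[z_1,\dots,z_n]$ with $T^i[z_1,\dots,z_i]=0$ for $1\le i\le n$, and, for fixed $k\ge1$ and $\bar z_1,\dots,\bar z_k\in B$, let $\bar X_n$ ($n\ge k$) be the set of elements of $X_n$ with $z_i=\bar z_i$ for $i\le k$. Put $\bar z(\varepsilon)=\sum_{i=1}^k\frac1{i!}\varepsilon^i\bar z_i$, and denote the Taylor coefficients at $\varepsilon=0$ by $G'[\bar z(\varepsilon)]=\sum_j\varepsilon^jL_j$ and $G[\bar z(\varepsilon)]=\sum_m\varepsilon^mg_m$. **The iteration.** Start with $N_0=B$, $R_0^c=\bar B$ and the lifts $E_0=I$, $K_0=0$. For $j=0,1,\dots,k$, given operator polynomials $E_j(\varepsilon)=\sum_p\varepsilon^pE_{j,p}$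 on $B$ and $K_j(\varepsilon)=\sum_p\varepsilon^pK_{j,p}$ from $\bar B$ to $B$, let $A_j=\sum_{p=0}^jL_{j-p}E_{j,p}$ and $$S_{j+1}=\tfrac{(2j)!}{j!}\,P_{R_j^c}A_j\big|_{N_j}\in L[N_j,R_j^c],\qquad N_{j+1}=\ker S_{j+1},\qquad R_{j+1}=S_{j+1}(N_j).$$ (In particular $S_1=G'[0]$, $S_2=P_{R_1^c}\,2G''[0]\bar z_1|_{N_1}$.) Assume that $R_{j+1}$ is closed and that closed subspaces $N_{j+1}^c,R_{j+1}^c$ are chosen with $N_j=N_{j+1}^c\oplus N_{j+1}$ and $R_j^c=R_{j+1}\oplus R_{j+1}^c$. Let $P_{R_{j+1}}$ and $P_{R_{j+1}^c}$ be the projections belonging to $\bar B=R_1\oplus\dots\oplus R_{j+1}\oplus R_{j+1}^c$, let $S_{j+1}^{-1}:R_{j+1}\to N_{j+1}^c$ be the inverse of the bijection $S_{j+1}|_{N_{j+1}^c}$, put $V_j=\frac{(2j)!}{j!}S_{j+1}^{-1}P_{R_{j+1}}$ and $$E_{j+1}(\varepsilon)=E_j(\varepsilon)-K_j(\varepsilon)A_j,\qquad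 K_{j+1}(\varepsilon)=\varepsilon\big(E_j(\varepsilon)V_j+K_j(\varepsilon)(I-A_jV_j)\big).$$ The result is a decomposition $$B=N_1^c\oplus\dots\oplus N_{k+1}^c\oplus N_{k+1},\qquad \bar B=R_1\oplus\dots\oplus R_{k+1}\oplus R_{k+1}^c .$$ **Constants.** Let $C_{0,i}=0$, $C_{j+1,j}=V_j$ and $C_{j+1,i}=C_{j,i}(I-A_jV_j)$ for $i\neq j$. Define linear operators $\hat M,\hat L$ on $B^{k+1}$ (components numbered $0,\dots,k$) by $$(\hat Mx)_r=\sum_{i=r}^k\tfrac{(2k+1-r)!}{(2k+1-i)!}E_{i,i-r}\,x_i,\qquad(\hat Lx)_i=x_i-\sum_{j=i+1}^k\tfrac{(2k+1-i)!}{(2k+1-j)!}C_{j,i}A_j\,x_j .$$ Let $w^{(0)}=0$ and, for $m=0,\dots,k$, with $y_m=-g_{k+1+m}-\sum_{q=0}^mL_{m-q}w^{(m)}_q$ and $s_m=V_my_m$, let $w^{(m+1)}_p=w^{(m)}_p+E_{m,p}s_m+K_{m,p}(y_m-A_ms_m)$. Put $\hat I_r=(2k+1-r)!\,w^{(k+1)}_{k-r}$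 for $0\le r\le k$. **Theorem 1 (Existence).** Suppose that $[\bar z_1,\dots,\bar z_k]$ are the first $k$ entries of some element of $X_{2k}$, that the iteration can be carried out as above with some choice of complements, and that the sum operator $$[S_1\ \dots\ S_{k+1}]:N_0\times\dots\times N_k\to\bar B,\quad(n_0,\dots,n_k)\mapsto S_1n_0+\dots+S_{k+1}n_k$$ is surjective. Then $\hat M$ and $\hat L$ are invertible in $L[B^{k+1},B^{k+1}]$, and there are maps $z(\varepsilon,\bar n)\in B$, $z_{k+1}(\varepsilon,\bar n),\dots,z_{2k+1}(\varepsilon,\bar n)\in B$ and $n_i^c(\varepsilon,\bar n)\in N_i^c$ ($1\le i\le k+1$) of $\varepsilon\in\mathbb K$ and $\bar n=(n_1,\dots,n_{k+1})\in N_1\times\dots\times N_{k+1}$ such that for every $C>0$ there is $\varepsilon_0>0$ for which all these maps are smooth on $\{|\varepsilon|<\varepsilon_0,\ \|\bar n\|<C\}$ and there satisfy $G[z(\varepsilon,\bar n)]=0$ and: (i) $z(\varepsilon,\bar n)=\varepsilon\bar z_1+\dots+\frac1{k!}\varepsilon^k\bar z_k+\frac1{(k+1)!}\varepsilon^{k+1}z_{k+1}(\varepsilon,\bar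 n)+\dots+\frac1{(2k+1)!}\varepsilon^{2k+1}z_{2k+1}(\varepsilon,\bar n)$; (ii) $[\bar z_1,\dots,\bar z_k,z_{k+1}(0,\bar n),\dots,z_{2k+1}(0,\bar n)]\in\bar X_{2k+1}$ and $[\bar z_1,\dots,\bar z_k,z_{k+1}(\varepsilon,\bar n),\dots,z_{2k}(\varepsilon,\bar n)]\in\bar X_{2k}$; (iii) $\begin{pmatrix}z_{2k+1}\\ \vdots\\ z_{k+1}\end{pmatrix}(\varepsilon,\bar n)=\hat I+\hat M\left[\begin{pmatrix}n_1^c\\ \vdots\\ n_{k+1}^c\end{pmatrix}(\varepsilon,\bar n)+\hat L\begin{pmatrix}n_1\\ \vdots\\ n_{k+1}\end{pmatrix}\right]$, and $(n_1^c,\dots,n_{k+1}^c)(0,\bar n)=0$. (iv) If $N^c=N_1^c\oplus\dots\oplus N_{k+1}^c$ is finite-dimensional, then $\dim\bar B=\dim N^c<\infty$, and for every choice of bases of $N^c$ and $\bar B$ there is a constant $c\ne0$ such that the determinant of the linearization $G_{n^c}[z(\varepsilon,\bar n)]=G'[z(\varepsilon,\bar n)]|_{N^c}\in L[N^c,\bar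 B]$ satisfies $$\det\{G_{n^c}[z(\varepsilon,\bar n)]\}=c\,\varepsilon^\chi+O(|\varepsilon|^{\chi+1}),\qquad\chi=\sum_{j=1}^kj\cdot\dim N_{j+1}^c,$$ as $\varepsilon\to0$, uniformly for $\bar n$ in bounded sets. -/

import Mathlib

open scoped ContDiff

noncomputable section

namespace SolutionCurve

section Coefficients

variable (𝕜 : Type*) [RCLike 𝕜] {B B' : Type*}
  [NormedAddCommGroup B] [NormedSpace 𝕜 B] [NormedAddCommGroup B'] [NormedSpace 𝕜 B']

/-- The polynomial curve `ε z₁ + … + (1/n!) εⁿ zₙ`. Tuples `[z₁, …, zₙ]` are written as sequences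
`z : ℕ → B` of which only the entries `1, …, n` are used. -/
def curve (n : ℕ) (z : ℕ → B) (ε : 𝕜) : B :=
  ∑ i ∈ Finset.Icc 1 n, (ε ^ i / (Nat.factorial i : 𝕜)) • z i

/-- `Tⁿ[z₁, …, zₙ]`: the coefficient of `εⁿ/n!` in the expansion of `G` along the curve. -/
def T (G : B → B') (n : ℕ) (z : ℕ → B) : B' :=
  iteratedDeriv n (fun ε : 𝕜 => G (curve 𝕜 n z ε)) 0

/-- `Xₙ`: the solutions `[z₁, …, zₙ]` of `T¹ = 0, …, Tⁿ = 0`. -/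
def X (G : B → B') (n : ℕ) : Set (ℕ → B) :=
  {z | ∀ m ∈ Finset.Icc 1 n, T 𝕜 G m z = 0}

/-- `X̄ₙ`, for `n ≥ k`: the elements of `Xₙ` with leading coefficients `[z̄₁, …, z̄ₖ]`. -/
def Xbar (G : B → B') (k : ℕ) (zb : ℕ → B) (n : ℕ) : Set (ℕ → B) :=
  {z | z ∈ X 𝕜 G n ∧ ∀ i ∈ Finset.Icc 1 k, z i = zb i}

/-- The coefficient of `εʲ` in the expansion of the linearization `G'` along the curve
`ε z̄₁ + … + (1/k!) εᵏ z̄ₖ`. -/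
def linCoeff (G : B → B') (k : ℕ) (zb : ℕ → B) (j : ℕ) : B →L[𝕜] B' :=
  (1 / (Nat.factorial j : 𝕜)) •
    iteratedDeriv j (fun ε : 𝕜 => fderiv 𝕜 G (curve 𝕜 k zb ε)) 0

/-- The coefficient of `εᵐ` in the expansion of `G` along `ε z̄₁ + … + (1/k!) εᵏ z̄ₖ`. -/
def valCoeff (G : B → B') (k : ℕ) (zb : ℕ → B) (m : ℕ) : B' :=
  (1 / (Nat.factorial m : 𝕜)) • iteratedDeriv m (fun ε : 𝕜 => G (curve 𝕜 k zb ε)) 0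

end Coefficients

section Decomposition

variable {𝕜 : Type*} [RCLike 𝕜] {B B' : Type*}
  [NormedAddCommGroup B] [NormedSpace 𝕜 B] [NormedAddCommGroup B'] [NormedSpace 𝕜 B']

/-- For `L(ε) = L₀ + ε L₁ + …` and `E(ε) = E₀ + ε E₁ + …`, the coefficient of `εʲ` in
`L(ε) E(ε)`. -/
def cauchyCoeff (L : ℕ → B →L[𝕜] B') (E : ℕ → B →L[𝕜] B) (j : ℕ) : B →L[𝕜] B' :=
  ∑ p ∈ Finset.range (j + 1), (L (j - p)).comp (E p)

/-- The scaling factor `(2j)!/j!` of the operator `S_{j+1}`. -/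
def scale (𝕜 : Type*) [RCLike 𝕜] (j : ℕ) : 𝕜 :=
  (Nat.factorial (2 * j) : 𝕜) / (Nat.factorial j : 𝕜)

/-- The chosen complements of the iteration, with the projections and inverses that they
determine (see `IsDecomposition`):
`Nc i = Nᵢᶜ` and `Rc i = Rᵢᶜ`, `P i` is the projection to `Rᵢᶜ` along `R₁ ⊕ … ⊕ Rᵢ`,
and `Sinv i` is `Sᵢ⁻¹ ∘ P_{Rᵢ}` with values in `Nᵢᶜ`. -/
structure DecompData (𝕜 B B' : Type*) [RCLike 𝕜]
    [NormedAddCommGroup B] [NormedSpace 𝕜 B] [NormedAddCommGroup B'] [NormedSpace 𝕜 B'] where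
  Nc : ℕ → Submodule 𝕜 B
  Rc : ℕ → Submodule 𝕜 B'
  P : ℕ → B' →L[𝕜] B'
  Sinv : ℕ → B' →L[𝕜] B

namespace DecompData

variable (D : DecompData 𝕜 B B') (L : ℕ → B →L[𝕜] B')

/-- The two families of lifting operators at stage `j`.
First component `E`: for `n ∈ Nⱼ`, the curve `E₀ n + ε E₁ n + …` starts with `E₀ n = n` and
`L(ε) E(ε) n = O(εʲ)`.
Second component `K`: for `y ∈ R₁ ⊕ … ⊕ Rⱼ`, the curve `K₀ y + ε K₁ y + …` starts with
`K₀ y = 0` and `L(ε) K(ε) y = εʲ y + O(εʲ⁺¹)`. -/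
def lifts : ℕ → (ℕ → B →L[𝕜] B) × (ℕ → B' →L[𝕜] B)
  | 0 => (fun p => if p = 0 then ContinuousLinearMap.id 𝕜 B else 0, fun _ => 0)
  | j + 1 =>
    let E := (lifts j).1
    let K := (lifts j).2
    let A := cauchyCoeff L E j
    let V : B' →L[𝕜] B := scale 𝕜 j • D.Sinv (j + 1)
    (fun p => E p - (K p).comp A,
     fun p => if p = 0 then 0 else
      (E (p - 1)).comp V + (K (p - 1)).comp (ContinuousLinearMap.id 𝕜 B' - A.comp V))

/-- `E_j = E_{j,0} + ε E_{j,1} + …`, the lift of stage `j`. -/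
def E (j p : ℕ) : B →L[𝕜] B := (D.lifts L j).1 p

/-- `K_j = K_{j,0} + ε K_{j,1} + …`, the correction of stage `j`. -/
def K (j p : ℕ) : B' →L[𝕜] B := (D.lifts L j).2 p

/-- `A_j`: the coefficient of `εʲ` in `L(ε) E_j(ε)`. -/
def A (j : ℕ) : B →L[𝕜] B' := cauchyCoeff L (D.E L j) j

/-- The operator `S_i`, given on all of `B`; the iteration uses its restriction to `N_{i-1}`.
Thus `S₁ = L₀`, `S₂ = 2 P₁ L₁`, `S₃ = 12 P₂ (L₂ - L₁ ∘ S₁⁻¹ P_{R₁} ∘ L₁)`, and so on. -/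
def S : ℕ → B →L[𝕜] B'
  | 0 => 0
  | j + 1 => scale 𝕜 j • (D.P j).comp (D.A L j)

/-- The filtration `N₀ = B`, `N_{i+1} = ker (S_{i+1} restricted to N_i)`. -/
def N : ℕ → Submodule 𝕜 B
  | 0 => ⊤
  | i + 1 => N i ⊓ LinearMap.ker (D.S L (i + 1) : B →ₗ[𝕜] B')

/-- The ranges `R_{i+1} = S_{i+1}(N_i)`. -/
def R : ℕ → Submodule 𝕜 B'
  | 0 => ⊥
  | i + 1 => (D.N L i).map (D.S L (i + 1) : B →ₗ[𝕜] B')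

/-- The decompositions `B = N₁ᶜ ⊕ … ⊕ N_{k+1}ᶜ ⊕ N_{k+1}` and
`B' = R₁ ⊕ … ⊕ R_{k+1} ⊕ R_{k+1}ᶜ` into closed subspaces, built up by
`N_i = N_{i+1}ᶜ ⊕ N_{i+1}` and `R_iᶜ = R_{i+1} ⊕ R_{i+1}ᶜ`. -/
structure IsDecomposition (k : ℕ) : Prop where
  Rc_zero : D.Rc 0 = ⊤
  N_sup : ∀ i ≤ k, D.Nc (i + 1) ⊔ D.N L (i + 1) = D.N L i
  N_disjoint : ∀ i ≤ k, Disjoint (D.Nc (i + 1)) (D.N L (i + 1))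
  Nc_closed : ∀ i ≤ k, IsClosed (D.Nc (i + 1) : Set B)
  R_sup : ∀ i ≤ k, D.R L (i + 1) ⊔ D.Rc (i + 1) = D.Rc i
  R_disjoint : ∀ i ≤ k, Disjoint (D.R L (i + 1)) (D.Rc (i + 1))
  R_closed : ∀ i ≤ k, IsClosed (D.R L (i + 1) : Set B')
  Rc_closed : ∀ i ≤ k, IsClosed (D.Rc (i + 1) : Set B')
  /-- `P i` is the projection to `R_iᶜ` along `R₁ ⊕ … ⊕ R_i`. -/
  P_Rc : ∀ i ≤ k + 1, ∀ y ∈ D.Rc i, D.P i y = y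
  P_R : ∀ i ≤ k + 1, ∀ j ≤ i, ∀ y ∈ D.R L j, D.P i y = 0
  /-- `Sinv (i+1)` is the composition of the projection `P_i - P_{i+1}` to `R_{i+1}` and the inverse
  of the bijection `S_{i+1} : N_{i+1}ᶜ → R_{i+1}`. -/
  Sinv_mem : ∀ i ≤ k, ∀ y, D.Sinv (i + 1) y ∈ D.Nc (i + 1)
  S_Sinv : ∀ i ≤ k, ∀ y, D.S L (i + 1) (D.Sinv (i + 1) y) = D.P i y - D.P (i + 1) y

/-- The sum operator `[S₁ … S_{k+1}]` on `N₀ × … × N_k`. -/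
def sumOp (k : ℕ) : (∀ i : Fin (k + 1), D.N L i) →L[𝕜] B' :=
  ∑ i : Fin (k + 1), (D.S L (i + 1)).comp
    ((D.N L i).subtypeL.comp (ContinuousLinearMap.proj i))

/-- `Nᶜ = N₁ᶜ ⊕ … ⊕ N_{k+1}ᶜ`. -/
def Nctot (k : ℕ) : Submodule 𝕜 B := ⨆ i : Fin (k + 1), D.Nc (i + 1)

/-- `χ = 1 · dim N₂ᶜ + … + k · dim N_{k+1}ᶜ`. -/
def chi (k : ℕ) : ℕ :=
  ∑ j ∈ Finset.range (k + 1), j * Module.finrank 𝕜 (D.Nc (j + 1))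

/-- Coordinates for `R₁ ⊕ … ⊕ R_j`: each `y` in that space is
`A₀ (C_{j,0} y) + … + A_{j-1} (C_{j,j-1} y)` with `C_{j,i} y ∈ N_{i+1}ᶜ`. -/
def C : ℕ → ℕ → B' →L[𝕜] B
  | 0, _ => 0
  | j + 1, i =>
    let V : B' →L[𝕜] B := scale 𝕜 j • D.Sinv (j + 1)
    if i = j then V else (C j i).comp (ContinuousLinearMap.id 𝕜 B' - (D.A L j).comp V)

/-- The matrix `M̂_{k+1}`; row `r` belongs to the coefficient `z_{2k+1-r}`, column `i` to the
variable from `N_i`. It is upper triangular with identity operators on the diagonal. -/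
def Mhat (k : ℕ) : (Fin (k + 1) → B) →L[𝕜] (Fin (k + 1) → B) :=
  ContinuousLinearMap.pi fun r => ∑ i : Fin (k + 1),
    if r ≤ i then
      ((Nat.factorial (2 * k + 1 - r) : 𝕜) / (Nat.factorial (2 * k + 1 - i) : 𝕜)) •
        (D.E L i (i - r)).comp (ContinuousLinearMap.proj i)
    else 0

/-- The matrix `L̂_{k+1}`; it is upper triangular with identity operators on the diagonal, and the
entry in row `i` and column `j > i` has values in `N_{i+1}ᶜ`. -/
def Lhat (k : ℕ) : (Fin (k + 1) → B) →L[𝕜] (Fin (k + 1) → B) :=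
  ContinuousLinearMap.pi fun i =>
    ContinuousLinearMap.proj i - ∑ j : Fin (k + 1),
      if i < j then
        ((Nat.factorial (2 * k + 1 - i) : 𝕜) / (Nat.factorial (2 * k + 1 - j) : 𝕜)) •
          ((D.C L j i).comp (D.A L j)).comp (ContinuousLinearMap.proj j)
      else 0

/-- The curve `w₀ + ε w₁ + …` built up in `m` steps so that
`L(ε) w(ε) + g₀ + ε g₁ + … = O(εᵐ)`. -/
def particular (g : ℕ → B') : ℕ → ℕ → B
  | 0, _ => 0
  | m + 1, p =>
    let w := particular g m
    let y : B' := - g m - ∑ q ∈ Finset.range (m + 1), L (m - q) (w q)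
    let s : B := scale 𝕜 m • D.Sinv (m + 1) y
    w p + (D.E L m p s + D.K L m p (y - D.A L m s))

/-- The vector `Î_{k+1}`; entry `r` belongs to the coefficient `z_{2k+1-r}`, and `g i` stands for the
coefficient of `εⁱ` in the expansion of `G` along `ε z̄₁ + … + (1/k!) εᵏ z̄ₖ`. -/
def Ihat (g : ℕ → B') (k : ℕ) (r : Fin (k + 1)) : B :=
  (Nat.factorial (2 * k + 1 - r) : 𝕜) •
    D.particular L (fun m => g (k + 1 + m)) (k + 1) (k - r)

end DecompData

end Decomposition

end SolutionCurve

end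

/-!
Write `K = k + 1`, `z̄(ε)` for the leading curve and `L(ε) = ∑ εʲ L_j`, `∑ εᵐ g_m` for the expansions
of the linearization and of the values of `G` along it. A curve `z̄(ε) + ε^K w(ε)` with
`w(ε) = w₀ + … + εᵏ w_k` satisfies

  `G(z̄ + ε^K w) = ∑ εᵐ g_m + ε^K L(ε) w(ε) + ε^(2K) q(z̄, ε^K w)(w, w)`

with `q` smooth (`exists_analyticAt_taylor_two`, `expansion_along`), so that the coefficients up to
the order `2k+1` are affine in `w`. In particular the equations `Tᵐ = 0`, `m ≤ 2k+1`, are linear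
equations for the Cauchy products of `L` and `w` (`T_eq_residual`).

These are solved by the lifts of the iteration: `L(ε) E_i(ε) n = εⁱ A_i n + O(ε^(i+1))` for `n ∈ N_i`
(`cauchyVec_lifts`). The curve `∑ ε^(k-i) E_i(ε) u_i` therefore contributes only `∑ A_i u_i` at the
order `k`. The free parameters drop out of this sum after the correction by `L̂` (`sum_A_Lhat`), and
`nᶜ ↦ ∑ A_i nᶜ_{i+1}` is an isomorphism onto `B'` because the sum operator is onto. With the
particular solution, whose construction cannot fail at the orders below `k` since `X_{2k}` is not
empty (`mem_N_and_P_cauchyVec`), the equation takes the form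

  `G(z) = ε^(2k+1) (y + ε Q(ε, n, y))`, where `y = ∑ A_i nᶜ_{i+1}` up to factorials.

The implicit function theorem gives `y`, hence `nᶜ`, as a function of `(ε, n)`. It is applied only at
one point, after a rescaling which makes the result uniform on bounded sets of `n`
(`exists_uniform_implicit`).

For the determinant, `G'(z) = L(ε) + O(ε^(k+1))` (`exists_fderiv_eq`), and on `Nᶜ` the factorization
`L(ε) Φ(ε) = (A + O(ε)) diag(ε⁰, …, εᵏ)` with `Φ(ε) n = ∑ E_i(ε) n_{i+1}`, `Φ(0)` and `A` invertible,
shows that the determinant is `ε^χ` times a differentiable function that does not vanish at `ε = 0`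
(`exists_det_expansion`).
-/

noncomputable section

open Filter Topology

/-! ### Difference quotients of analytic functions -/

namespace SolutionCurve

section Hadamard

variable {𝕜 : Type*} [RCLike 𝕜] {E F : Type*}
  [NormedAddCommGroup E] [NormedSpace 𝕜 E] [NormedAddCommGroup F] [NormedSpace 𝕜 F]

/-- The `n`-th term of the power series in `(a, h)` of the difference quotient of a power series
`p`. It comes from replacing the arguments `a + h` of `p (n + 1)` by `a` one after the other. -/
def diffQuotSeries (p : FormalMultilinearSeries 𝕜 E F) :
    FormalMultilinearSeries 𝕜 (E × E) (E →L[𝕜] F) := fun n =>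
  ∑ j : Fin (n + 1), ((ContinuousMultilinearMap.compContinuousLinearMapL
    (fun i : Fin n => if j.succAbove i < j then
      ContinuousLinearMap.fst 𝕜 E E + ContinuousLinearMap.snd 𝕜 E E
      else ContinuousLinearMap.fst 𝕜 E E)).comp ((p (n + 1)).curryMid j)).flipMultilinear

lemma diffQuotSeries_apply (p : FormalMultilinearSeries 𝕜 E F) (n : ℕ) (a h : E) :
    diffQuotSeries p n (fun _ => (a, h)) h =
      p (n + 1) (fun _ => a + h) - p (n + 1) (fun _ => a) := by
  have key := (p (n + 1)).toMultilinearMap.map_piecewise_sub_map_piecewise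
    (fun _ => a + h) (fun _ => a) (fun _ => 0) Finset.univ
  simp only [Finset.piecewise_univ, Finset.mem_univ, if_true, add_sub_cancel_left] at key
  refine Eq.trans ?_ key.symm
  simp only [diffQuotSeries, sum_apply]
  refine Finset.sum_congr rfl fun j _ => ?_
  rw [ContinuousLinearMap.flipMultilinear_apply_apply, ContinuousLinearMap.comp_apply,
    ContinuousMultilinearMap.compContinuousLinearMapL_apply,
    ContinuousMultilinearMap.compContinuousLinearMap_apply,
    ContinuousMultilinearMap.curryMid_apply]
  refine congrArg (p (n + 1)) (funext fun l => ?_)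
  induction l using Fin.succAboveCases j with
  | x => simp
  | p i =>
    simp only [Fin.insertNth_apply_succAbove, Fin.succAbove_ne, if_false]
    split_ifs <;> simp

lemma norm_sum_univ_le {V : Type*} [SeminormedAddCommGroup V] {n : ℕ} (g : Fin n → V) (c : ℝ)
    (h : ∀ j, ‖g j‖ ≤ c) : ‖∑ j, g j‖ ≤ n * c :=
  (norm_sum_le_of_le Finset.univ fun j _ => h j).trans (by simp)

lemma norm_diffQuotSeries_le (p : FormalMultilinearSeries 𝕜 E F) (n : ℕ) :
    ‖diffQuotSeries p n‖ ≤ (n + 1) * (2 ^ n * ‖p (n + 1)‖) := by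
  have key := norm_sum_univ_le (fun j : Fin (n + 1) =>
    ((ContinuousMultilinearMap.compContinuousLinearMapL
    (fun i : Fin n => if j.succAbove i < j then
      ContinuousLinearMap.fst 𝕜 E E + ContinuousLinearMap.snd 𝕜 E E
      else ContinuousLinearMap.fst 𝕜 E E)).comp ((p (n + 1)).curryMid j)).flipMultilinear)
      (2 ^ n * ‖p (n + 1)‖) fun j => ?_
  · exact_mod_cast key
  have h1 : ∀ f : E →L[𝕜] ContinuousMultilinearMap 𝕜 (fun _ : Fin n => E × E) F,
      ‖f.flipMultilinear‖ ≤ ‖f‖ := fun f =>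
    MultilinearMap.mkContinuous_norm_le _ (norm_nonneg _) _
  refine (h1 _).trans ((ContinuousLinearMap.opNorm_comp_le _ _).trans ?_)
  rw [ContinuousMultilinearMap.norm_curryMid]
  refine mul_le_mul_of_nonneg_right ?_ (norm_nonneg _)
  refine (ContinuousMultilinearMap.norm_compContinuousLinearMapL_le F _).trans ?_
  refine (Finset.prod_le_prod (g := fun _ => (2 : ℝ)) (fun _ _ => norm_nonneg _)
    fun i _ => ?_).trans (by simp)
  have hf := ContinuousLinearMap.norm_fst_le 𝕜 E E
  have hs := ContinuousLinearMap.norm_snd_le 𝕜 E E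
  split_ifs
  · exact (norm_add_le _ _).trans (by linarith)
  · linarith

lemma diffQuotSeries_radius_pos (p : FormalMultilinearSeries 𝕜 E F) (hp : 0 < p.radius) :
    0 < (diffQuotSeries p).radius := by
  obtain ⟨r, hr0, hr⟩ := ENNReal.lt_iff_exists_nnreal_btwn.1 hp
  have hr0' : 0 < r := by exact_mod_cast hr0
  obtain ⟨C, hC, hb⟩ := p.norm_mul_pow_le_of_lt_radius hr
  have : ((r / 4 : NNReal) : ENNReal) ≤ (diffQuotSeries p).radius := by
    refine FormalMultilinearSeries.le_radius_of_bound _ (C / r) fun n => ?_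
    have h2 : ((n : ℝ) + 1) ≤ 2 ^ n := by exact_mod_cast Nat.lt_two_pow_self (n := n)
    have hrr : (0 : ℝ) < r := by exact_mod_cast hr0'
    calc ‖diffQuotSeries p n‖ * ((r / 4 : NNReal) : ℝ) ^ n
        ≤ (2 ^ n * (2 ^ n * ‖p (n + 1)‖)) * ((r / 4 : NNReal) : ℝ) ^ n := by
          gcongr
          exact (norm_diffQuotSeries_le p n).trans (by gcongr)
      _ = ‖p (n + 1)‖ * (r : ℝ) ^ (n + 1) / r := by
          push_cast
          rw [div_pow, show (4 : ℝ) = 2 * 2 by norm_num, mul_pow]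
          field_simp
          ring
      _ ≤ C / r := by gcongr; exact hb _
  exact lt_of_lt_of_le (by positivity) this

/-- Hadamard's lemma: the difference quotient of an analytic function is analytic in the pair of
base point and increment. -/
lemma exists_analyticAt_diffQuot [CompleteSpace F] {f : E → F} (hf : AnalyticAt 𝕜 f 0) :
    ∃ q : E × E → E →L[𝕜] F, AnalyticAt 𝕜 q 0 ∧
      ∀ᶠ x : E × E in 𝓝 0, f (x.1 + x.2) = f x.1 + q x x.2 := by
  obtain ⟨p, r, hp⟩ := hf
  have hq := (diffQuotSeries p).hasFPowerSeriesOnBall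
    (diffQuotSeries_radius_pos p (hp.r_pos.trans_le hp.r_le))
  refine ⟨(diffQuotSeries p).sum, hq.analyticAt, ?_⟩
  have e1 : ∀ᶠ x : E × E in 𝓝 0, x.1 ∈ Metric.eball (0 : E) r :=
    continuous_fst.tendsto' _ _ rfl |>.eventually (Metric.eball_mem_nhds _ hp.r_pos)
  have e2 : ∀ᶠ x : E × E in 𝓝 0, x.1 + x.2 ∈ Metric.eball (0 : E) r :=
    (continuous_fst.add continuous_snd).tendsto' _ _ (by simp) |>.eventually
      (Metric.eball_mem_nhds _ hp.r_pos)
  have e3 : ∀ᶠ x : E × E in 𝓝 0, x ∈ Metric.eball (0 : E × E) (diffQuotSeries p).radius :=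
    Metric.eball_mem_nhds _ hq.r_pos
  filter_upwards [e1, e2, e3] with x h1 h2 h3
  have s1 := hp.hasSum h1
  have s2 := hp.hasSum h2
  have s3 := hq.hasSum h3
  simp only [zero_add] at s1 s2 s3
  have s4 := s3.mapL (ContinuousLinearMap.apply 𝕜 F x.2)
  have s5 := s2.sub s1
  rw [← hasSum_nat_add_iff' 1] at s5
  simp only [ContinuousLinearMap.apply_apply] at s4
  have e : (fun n => diffQuotSeries p n (fun _ => x) x.2) = fun n =>
      p (n + 1) (fun _ => x.1 + x.2) - p (n + 1) (fun _ => x.1) := by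
    funext n; exact diffQuotSeries_apply p n x.1 x.2
  rw [e] at s4
  have h0 : ∀ v w : Fin 0 → E, p 0 v = p 0 w := fun v w => by rw [Subsingleton.elim v w]
  have s6 := s4.unique s5
  simp only [Finset.range_one, Finset.sum_singleton] at s6
  rw [h0 _ (fun _ => x.1), sub_self, sub_zero] at s6
  rw [s6]; abel

/-- Taylor's formula of second order, with a remainder that is smooth in the pair of base point
and increment. -/
lemma exists_analyticAt_taylor_two [CompleteSpace F] {f : E → F} (hf : AnalyticAt 𝕜 f 0) :
    ∃ q : E × E → E →L[𝕜] E →L[𝕜] F, ContDiffAt 𝕜 ω q 0 ∧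
      ∀ᶠ x : E × E in 𝓝 0, f (x.1 + x.2) = f x.1 + fderiv 𝕜 f x.1 x.2 + q x x.2 x.2 := by
  obtain ⟨q₁, hq₁, h₁⟩ := exists_analyticAt_diffQuot hf
  obtain ⟨q₂, hq₂, h₂⟩ := exists_analyticAt_diffQuot hq₁
  have hder : ∀ᶠ x : E × E in 𝓝 0, q₁ (x.1, 0) = fderiv 𝕜 f x.1 := by
    have c1 : ∀ᶠ x : E × E in 𝓝 0, ContinuousAt q₁ (x.1, 0) :=
      ((continuous_fst.prodMk continuous_const).tendsto' (0 : E × E) (0 : E × E) rfl).eventually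
        (hq₁.eventually_analyticAt.mono fun y hy => hy.continuousAt)
    have c2 : ∀ᶠ x : E × E in 𝓝 0, ∀ᶠ y in 𝓝 (x.1, (0 : E)),
        f (y.1 + y.2) = f y.1 + q₁ y y.2 :=
      ((continuous_fst.prodMk continuous_const).tendsto' (0 : E × E) (0 : E × E) rfl).eventually
        h₁.eventually_nhds
    filter_upwards [c1, c2] with x hx1 hx2
    have hd : HasFDerivAt f (q₁ (x.1, 0)) x.1 := by
      rw [hasFDerivAt_iff_isLittleO_nhds_zero]
      have t0 : Tendsto (fun h : E => (x.1, h)) (𝓝 0) (𝓝 (x.1, 0)) :=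
        (continuous_const.prodMk continuous_id).tendsto' _ _ rfl
      have t1 : Tendsto (fun h : E => q₁ (x.1, h) - q₁ (x.1, 0)) (𝓝 0) (𝓝 0) := by
        have := (hx1.tendsto.comp t0).sub_const (q₁ (x.1, 0))
        simpa using this
      have e : (fun h => f (x.1 + h) - f x.1 - q₁ (x.1, 0) h) =ᶠ[𝓝 0]
          fun h => (q₁ (x.1, h) - q₁ (x.1, 0)) h := by
        filter_upwards [t0.eventually hx2] with h hh
        rw [hh]; simp
      refine e.trans_isLittleO ?_
      rw [Asymptotics.isLittleO_iff]
      intro c hc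
      filter_upwards [t1.norm.eventually (gt_mem_nhds (by simpa using hc))] with h hh
      exact (ContinuousLinearMap.le_opNorm _ _).trans
        (mul_le_mul_of_nonneg_right hh.le (norm_nonneg _))
    exact hd.fderiv.symm
  let j : E × E →L[𝕜] (E × E) × (E × E) :=
    ((ContinuousLinearMap.fst 𝕜 E E).prod 0).prod
      ((0 : E × E →L[𝕜] E).prod (ContinuousLinearMap.snd 𝕜 E E))
  have hj : Tendsto j (𝓝 0) (𝓝 0) := j.continuous.tendsto' _ _ (by simp)
  refine ⟨fun x => (q₂ (j x)).comp (ContinuousLinearMap.inr 𝕜 E E), ?_, ?_⟩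
  · have : AnalyticAt 𝕜 (fun x => q₂ (j x)) 0 :=
      AnalyticAt.comp (by simpa using hq₂) (j.analyticAt 0)
    exact this.contDiffAt.clm_comp contDiffAt_const
  · filter_upwards [h₁, hj.eventually h₂, hder] with x hx1 hx2 hx3
    have : q₁ x = q₁ (x.1, 0) + q₂ (j x) (0, x.2) := by
      have := hx2
      simpa [j] using this
    rw [hx1, this, hx3]
    simp [add_assoc]

end Hadamard

end SolutionCurve

/-! ### A uniform implicit function theorem -/

namespace SolutionCurve

section Implicit

variable {𝕜 : Type*} [RCLike 𝕜] {X Y : Type*}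
  [NormedAddCommGroup X] [NormedSpace 𝕜 X] [CompleteSpace X]
  [NormedAddCommGroup Y] [NormedSpace 𝕜 Y] [CompleteSpace Y]

/-- An implicit function theorem for `y + ε Q(ε, n, y) = 0` near `ε = 0`, uniform for `n` in bounded
sets. The substitution `ε = s² t`, `n = s⁻¹ m` turns a bounded set of `n` into a neighbourhood of
`m = 0`, so that the usual theorem at the single point `s = t = 0`, `m = 0`, `y = 0` suffices,
provided that the rescaled equation is still regular there. The solutions belonging to different
bounds `C` agree since they are locally unique. -/
lemma exists_uniform_implicit (Q : 𝕜 → X → Y → Y) (H : (𝕜 × 𝕜 × X) × Y → Y)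
    (hH : ContDiffAt 𝕜 ω H 0) (hH0 : ∀ s m y, H ((s, 0, m), y) = y)
    (hQ : ∀ s t m y, s ≠ 0 →
      H ((s, t, m), y) = y + (s ^ 2 * t) • Q (s ^ 2 * t) (s⁻¹ • m) y) :
    ∃ y : 𝕜 → X → Y, (∀ n, y 0 n = 0) ∧ ∀ C : ℝ, 0 < C → ∃ ε₀ : ℝ, 0 < ε₀ ∧
      ContDiffOn 𝕜 ∞ (Function.uncurry y) {q | ‖q.1‖ < ε₀ ∧ ‖q.2‖ < C} ∧
      ∀ ε n, ‖ε‖ < ε₀ → ‖n‖ < C → ‖y ε n‖ < 1 ∧ y ε n + ε • Q ε n (y ε n) = 0 := by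
  classical
  have hω : (ω : ℕ∞ω) ≠ 0 := by simp
  have h00 : H 0 = 0 := hH0 0 0 0
  have hder : fderiv 𝕜 H 0 ∘L .inr 𝕜 (𝕜 × 𝕜 × X) Y = .id 𝕜 Y := by
    have h1 : HasFDerivAt (fun y : Y => H (0, y))
        (fderiv 𝕜 H 0 ∘L .inr 𝕜 (𝕜 × 𝕜 × X) Y) 0 :=
      HasFDerivAt.comp (g := H) (0 : Y) (hH.differentiableAt hω).hasFDerivAt
        (ContinuousLinearMap.inr 𝕜 (𝕜 × 𝕜 × X) Y).hasFDerivAt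
    have h2 : (fun y : Y => H (0, y)) = id := funext fun y => hH0 0 0 y
    rw [h2] at h1
    exact h1.unique (hasFDerivAt_id _)
  have hinv : (fderiv 𝕜 H 0 ∘L .inr 𝕜 (𝕜 × 𝕜 × X) Y).IsInvertible := by
    rw [hder]; exact ContinuousLinearMap.isInvertible_equiv (f := ContinuousLinearEquiv.refl 𝕜 Y)
  set φ := hH.implicitFunction hω hinv with hφ
  have hφ0 : φ 0 = 0 := hH.implicitFunction_apply_self hω hinv
  have hφs : ContDiffAt 𝕜 ω φ 0 := hH.contDiffAt_implicitFunction hω hinv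
  have hu := hH.eventually_apply_eq_iff_implicitFunction hω hinv
  obtain ⟨δ₁, hδ₁, hu⟩ := Metric.eventually_nhds_iff_ball.1 hu
  have he : ∀ᶠ p in 𝓝 (0 : 𝕜 × 𝕜 × X), H (p, φ p) = 0 ∧ ContDiffAt 𝕜 ω φ p ∧
      ‖φ p‖ < min δ₁ 1 := by
    refine (h00 ▸ hH.eventually_apply_implicitFunction hω hinv).and
      ((hφs.eventually (by simp)).and ?_)
    have : Tendsto (fun p => ‖φ p‖) (𝓝 0) (𝓝 0) := by
      simpa [hφ0] using hφs.continuousAt.tendsto.norm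
    exact this.eventually (gt_mem_nhds (lt_min hδ₁ one_pos))
  obtain ⟨δ₂, hδ₂, he⟩ := Metric.eventually_nhds_iff_ball.1 he
  let y : 𝕜 → X → Y := fun ε n =>
    if h : ∃ y : Y, ‖y‖ < min δ₁ 1 ∧ y + ε • Q ε n y = 0 then h.choose else 0
  have hy : ∀ ε n, (∃ y : Y, ‖y‖ < min δ₁ 1 ∧ y + ε • Q ε n y = 0) →
      ‖y ε n‖ < min δ₁ 1 ∧ y ε n + ε • Q ε n (y ε n) = 0 := fun ε n h => by
    simp only [y, dif_pos h]; exact h.choose_spec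
  refine ⟨y, fun n => ?_, fun C hC => ?_⟩
  · have := (hy 0 n ⟨0, by simp [hδ₁], by simp⟩).2
    simpa using this
  · let δ := min δ₁ δ₂
    have hδ : 0 < δ := lt_min hδ₁ hδ₂
    let σ : ℝ := δ / (2 * (C + 1))
    have hσ : 0 < σ := by positivity
    have hσ1 : σ < δ := by
      rw [div_lt_iff₀ (by positivity)]; nlinarith
    have hσC : σ * C < δ := by
      rw [div_mul_eq_mul_div, div_lt_iff₀ (by positivity)]; nlinarith
    let s : 𝕜 := (σ : 𝕜)
    have hs : s ≠ 0 := by simpa [s] using hσ.ne'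
    have hsn : ‖s‖ = σ := by simp [s, abs_of_pos hσ]
    let p : 𝕜 × X → 𝕜 × 𝕜 × X := fun q => (s, (s ^ 2)⁻¹ * q.1, s • q.2)
    have hp : ∀ q ∈ {q : 𝕜 × X | ‖q.1‖ < σ ^ 2 * δ ∧ ‖q.2‖ < C}, ‖p q‖ < δ := by
      rintro q ⟨h1, h2⟩
      simp only [p, Prod.norm_def, norm_mul, norm_inv, norm_pow, norm_smul, hsn]
      refine max_lt hσ1 (max_lt ?_ ?_)
      · rw [inv_mul_lt_iff₀ (by positivity)]; exact h1
      · exact (mul_le_mul_of_nonneg_left h2.le hσ.le).trans_lt hσC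
    have hHp : ∀ (q : 𝕜 × X) (v : Y), H (p q, v) = v + q.1 • Q q.1 q.2 v := fun q v => by
      have e1 : s ^ 2 * ((s ^ 2)⁻¹ * q.1) = q.1 := by field_simp
      have e2 : s⁻¹ • s • q.2 = q.2 := by rw [smul_smul, inv_mul_cancel₀ hs, one_smul]
      simp only [p, hQ _ _ _ _ hs, e1, e2]
    have hyφ : ∀ q ∈ {q : 𝕜 × X | ‖q.1‖ < σ ^ 2 * δ ∧ ‖q.2‖ < C},
        (‖y q.1 q.2‖ < min δ₁ 1 ∧ y q.1 q.2 + q.1 • Q q.1 q.2 (y q.1 q.2) = 0) ∧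
        y q.1 q.2 = φ (p q) := by
      intro q hq
      have hpq := hp q hq
      have h := he (p q) (by simpa using hpq.trans_le (min_le_right _ _))
      have h' := hy q.1 q.2 ⟨φ (p q), h.2.2, by rw [← hHp]; exact h.1⟩
      refine ⟨h', ?_⟩
      have h3 := hu (p q, y q.1 q.2) (by
        simp only [Metric.mem_ball, dist_zero_right, Prod.norm_def]
        exact max_lt (hpq.trans_le (min_le_left _ _)) (h'.1.trans_le (min_le_left _ _)))
      rw [h00, hHp] at h3
      exact (h3.1 h'.2).symm
    refine ⟨σ ^ 2 * δ, by positivity, ?_, fun ε n hε hn => ?_⟩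
    · have : ContDiffOn 𝕜 ∞ (fun q => φ (p q)) {q : 𝕜 × X | ‖q.1‖ < σ ^ 2 * δ ∧ ‖q.2‖ < C} := by
        intro q hq
        have hpq := hp q hq
        have h := he (p q) (by simpa using hpq.trans_le (min_le_right _ _))
        have hps : ContDiffAt 𝕜 ∞ p q := by fun_prop
        exact ((h.2.1.of_le le_top).comp q hps).contDiffWithinAt
      exact this.congr fun q hq => (hyφ q hq).2
    · have := (hyφ (ε, n) ⟨hε, hn⟩).1
      exact ⟨this.1.trans_le (min_le_right _ _), this.2⟩

end Implicit

end SolutionCurve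

/-! ### The algebra of the iteration -/

namespace SolutionCurve

section CauchyProduct

variable {𝕜 : Type*} [RCLike 𝕜] {B B' : Type*}
  [NormedAddCommGroup B] [NormedSpace 𝕜 B] [NormedAddCommGroup B'] [NormedSpace 𝕜 B']

/-- For `L(ε) = L₀ + ε L₁ + …` and a curve `w(ε) = w₀ + ε w₁ + …`, the coefficient of `εᵐ` in
`L(ε) w(ε)`. -/
def cauchyVec (L : ℕ → B →L[𝕜] B') (w : ℕ → B) (m : ℕ) : B' :=
  ∑ q ∈ Finset.range (m + 1), L (m - q) (w q)

variable (L : ℕ → B →L[𝕜] B')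

lemma cauchyCoeff_apply (E : ℕ → B →L[𝕜] B) (j : ℕ) (x : B) :
    cauchyCoeff L E j x = cauchyVec L (fun p => E p x) j := by
  simp [cauchyCoeff, cauchyVec]

lemma cauchyVec_add (v w : ℕ → B) (m : ℕ) :
    cauchyVec L (fun p => v p + w p) m = cauchyVec L v m + cauchyVec L w m := by
  simp [cauchyVec, Finset.sum_add_distrib]

lemma cauchyVec_sub (v w : ℕ → B) (m : ℕ) :
    cauchyVec L (fun p => v p - w p) m = cauchyVec L v m - cauchyVec L w m := by
  simp [cauchyVec]

lemma cauchyVec_sum {ι : Type*} (s : Finset ι) (v : ι → ℕ → B) (m : ℕ) :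
    cauchyVec L (fun p => ∑ i ∈ s, v i p) m = ∑ i ∈ s, cauchyVec L (v i) m := by
  simp only [cauchyVec, map_sum]
  exact Finset.sum_comm

lemma cauchyVec_at_zero (w : ℕ → B) : cauchyVec L w 0 = L 0 (w 0) := by
  simp [cauchyVec]

lemma cauchyVec_succ_of_zero {w : ℕ → B} (h : w 0 = 0) (m : ℕ) :
    cauchyVec L w (m + 1) = cauchyVec L (fun p => w (p + 1)) m := by
  rw [cauchyVec, Finset.sum_range_succ', h, map_zero, add_zero, cauchyVec]
  simp

lemma cauchyVec_shift (c : ℕ) (v : ℕ → B) (m : ℕ) :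
    cauchyVec L (fun p => if c ≤ p then v (p - c) else 0) m =
      if c ≤ m then cauchyVec L v (m - c) else 0 := by
  induction c generalizing m with
  | zero => simp
  | succ c ih =>
    cases m with
    | zero => simp [cauchyVec]
    | succ m =>
      rw [cauchyVec_succ_of_zero L (by simp)]
      simpa using ih m

end CauchyProduct

namespace DecompData

variable {𝕜 : Type*} [RCLike 𝕜] {B B' : Type*}
  [NormedAddCommGroup B] [NormedSpace 𝕜 B] [NormedAddCommGroup B'] [NormedSpace 𝕜 B']
  (D : DecompData 𝕜 B B') (L : ℕ → B →L[𝕜] B')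

lemma scale_ne_zero (j : ℕ) : scale 𝕜 j ≠ 0 :=
  div_ne_zero (by exact_mod_cast Nat.factorial_ne_zero _)
    (by exact_mod_cast Nat.factorial_ne_zero _)

/-- `V_j`: the inverse of `P_j A_j` on `R_{j+1}`, with values in `N_{j+1}ᶜ`. -/
def V (j : ℕ) : B' →L[𝕜] B := scale 𝕜 j • D.Sinv (j + 1)

lemma E_zero_zero : D.E L 0 0 = ContinuousLinearMap.id 𝕜 B := by simp [E, lifts]

lemma E_succ (j p : ℕ) : D.E L (j + 1) p = D.E L j p - (D.K L j p).comp (D.A L j) := rfl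

lemma K_zero (p : ℕ) : D.K L 0 p = 0 := rfl

lemma K_succ_zero (j : ℕ) : D.K L (j + 1) 0 = 0 := rfl

lemma K_succ_succ (j p : ℕ) : D.K L (j + 1) (p + 1) = (D.E L j p).comp (D.V j) +
    (D.K L j p).comp (ContinuousLinearMap.id 𝕜 B' - (D.A L j).comp (D.V j)) := rfl

lemma C_succ_self (j : ℕ) : D.C L (j + 1) j = D.V j := by simp [C, V]

lemma C_succ_of_ne {i j : ℕ} (h : i ≠ j) : D.C L (j + 1) i =
    (D.C L j i).comp (ContinuousLinearMap.id 𝕜 B' - (D.A L j).comp (D.V j)) := by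
  simp [C, V, h]

lemma K_coeff_zero (j : ℕ) : D.K L j 0 = 0 := by
  cases j <;> rfl

lemma E_coeff_zero (j : ℕ) : D.E L j 0 = ContinuousLinearMap.id 𝕜 B := by
  induction j with
  | zero => exact D.E_zero_zero L
  | succ j ih => rw [E_succ, ih, K_coeff_zero]; simp

lemma A_apply (j : ℕ) (x : B) : D.A L j x = cauchyVec L (fun p => D.E L j p x) j :=
  cauchyCoeff_apply L _ j x

lemma A_zero_apply (x : B) : D.A L 0 x = L 0 x := by
  rw [A_apply, cauchyVec_at_zero, E_zero_zero]; rfl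

lemma S_succ_apply (j : ℕ) (x : B) : D.S L (j + 1) x = scale 𝕜 j • D.P j (D.A L j x) := rfl

lemma N_succ_le (j : ℕ) : D.N L (j + 1) ≤ D.N L j := inf_le_left

lemma N_anti {i j : ℕ} (h : i ≤ j) : D.N L j ≤ D.N L i :=
  antitone_nat_of_succ_le (D.N_succ_le L) h

lemma P_A_eq_zero_iff (j : ℕ) (x : B) : D.P j (D.A L j x) = 0 ↔ D.S L (j + 1) x = 0 := by
  rw [S_succ_apply, smul_eq_zero]
  simp [scale_ne_zero]

lemma mem_N_succ_iff {j : ℕ} {x : B} :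
    x ∈ D.N L (j + 1) ↔ x ∈ D.N L j ∧ D.P j (D.A L j x) = 0 := by
  rw [P_A_eq_zero_iff]; rfl

namespace IsDecomposition

variable {D L} {k : ℕ} (hD : D.IsDecomposition L k)
include hD

lemma Nc_le {i : ℕ} (hi : i ≤ k) : D.Nc (i + 1) ≤ D.N L i := hD.N_sup i hi ▸ le_sup_left

lemma V_mem {i : ℕ} (hi : i ≤ k) (y : B') : D.V i y ∈ D.Nc (i + 1) :=
  (D.Nc (i + 1)).smul_mem _ (hD.Sinv_mem i hi y)

lemma P_zero (y : B') : D.P 0 y = y := hD.P_Rc 0 (by omega) y (by rw [hD.Rc_zero]; trivial)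

lemma P_A_V {i : ℕ} (hi : i ≤ k) (y : B') : D.P i (D.A L i (D.V i y)) = D.P i y - D.P (i + 1) y := by
  rw [← hD.S_Sinv i hi y, S_succ_apply, V]
  simp

lemma P_P {i j : ℕ} (hij : i ≤ j) (hj : j ≤ k + 1) (y : B') : D.P j (D.P i y) = D.P j y := by
  induction i with
  | zero => rw [hD.P_zero]
  | succ i ih =>
    have h : D.P j (D.S L (i + 1) (D.Sinv (i + 1) y)) = 0 :=
      hD.P_R j hj (i + 1) hij _ ⟨_, hD.Nc_le (by omega) (hD.Sinv_mem i (by omega) y), rfl⟩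
    rw [hD.S_Sinv i (by omega), map_sub, ih (by omega)] at h
    exact (sub_eq_zero.1 h).symm

lemma P_eq_zero_of_le {i j : ℕ} (hij : i ≤ j) (hj : j ≤ k + 1) {y : B'} (h : D.P i y = 0) :
    D.P j y = 0 := by
  rw [← hD.P_P hij hj, h, map_zero]

lemma P_succ_A {i : ℕ} (hi : i ≤ k) {x : B} (hx : x ∈ D.N L i) : D.P (i + 1) (D.A L i x) = 0 := by
  have h : D.P (i + 1) (D.S L (i + 1) x) = 0 :=
    hD.P_R (i + 1) (by omega) (i + 1) le_rfl _ ⟨x, hx, rfl⟩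
  rw [S_succ_apply, map_smul, hD.P_P (by omega) (by omega)] at h
  exact (smul_eq_zero.1 h).resolve_left (scale_ne_zero i)

lemma P_sub_A_V {i : ℕ} (hi : i ≤ k) (y : B') :
    D.P i (y - D.A L i (D.V i y)) = D.P (i + 1) y := by
  rw [map_sub, hD.P_A_V hi, sub_sub_cancel]

/-- The defining properties of the lifts: `L(ε) E_j(ε) n = O(εʲ)` for `n ∈ N_j`, and
`L(ε) K_j(ε) y = εʲ y + O(εʲ⁺¹)` for `y ∈ ker P_j = R₁ ⊕ … ⊕ R_j`. -/
lemma cauchyVec_lifts {j : ℕ} (hj : j ≤ k + 1) :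
    (∀ x ∈ D.N L j, ∀ i < j, cauchyVec L (fun p => D.E L j p x) i = 0) ∧
    ∀ y, D.P j y = 0 → (∀ i < j, cauchyVec L (fun p => D.K L j p y) i = 0) ∧
      cauchyVec L (fun p => D.K L j p y) j = y := by
  induction j with
  | zero =>
    refine ⟨fun x _ i hi => absurd hi (by omega), fun y hy => ⟨fun i hi => absurd hi (by omega), ?_⟩⟩
    rw [hD.P_zero] at hy
    simp [cauchyVec, K_zero, hy]
  | succ j ih =>
    obtain ⟨ihE, ihK⟩ := ih (by omega)
    constructor
    · intro x hx i hi
      obtain ⟨hx1, hx2⟩ := (D.mem_N_succ_iff L).1 hx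
      obtain ⟨h1, h2⟩ := ihK _ hx2
      have e : (fun p => D.E L (j + 1) p x) =
          fun p => D.E L j p x - D.K L j p (D.A L j x) := by
        funext p; simp [E_succ]
      rw [e, cauchyVec_sub]
      rcases Nat.lt_succ_iff_lt_or_eq.1 hi with hi | rfl
      · rw [ihE x hx1 i hi, h1 i hi, sub_zero]
      · rw [h2, A_apply, sub_self]
    · intro y hy
      have hy' : D.P j (y - D.A L j (D.V j y)) = 0 := by rw [hD.P_sub_A_V (by omega), hy]
      obtain ⟨h1, h2⟩ := ihK _ hy'
      have hV : D.V j y ∈ D.N L j := hD.Nc_le (by omega) (hD.V_mem (by omega) y)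
      have e : ∀ i, cauchyVec L (fun p => D.K L (j + 1) p y) (i + 1) =
          cauchyVec L (fun p => D.E L j p (D.V j y)) i +
            cauchyVec L (fun p => D.K L j p (y - D.A L j (D.V j y))) i := fun i => by
        rw [cauchyVec_succ_of_zero L (by simp [K_succ_zero]), ← cauchyVec_add]
        simp [K_succ_succ]
      refine ⟨fun i hi => ?_, ?_⟩
      · cases i with
        | zero => simp [cauchyVec, K_succ_zero]
        | succ i => rw [e, ihE _ hV i (by omega), h1 i (by omega), add_zero]
      · rw [e, h2, ← A_apply, add_sub_cancel]

/-- A curve with `L(ε) d(ε) = O(εᵐ)` starts in `N_m`, and the coefficient of `εᵐ` in `L(ε) d(ε)`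
lies in `R₁ ⊕ … ⊕ R_{m+1}`. The reason is that `d(ε)` and `E_m(ε) d₀` differ by `ε` times a curve
of the same kind. -/
lemma mem_N_and_P_cauchyVec {m : ℕ} (hm : m ≤ k) (d : ℕ → B)
    (hd : ∀ i < m, cauchyVec L d i = 0) :
    d 0 ∈ D.N L m ∧ D.P (m + 1) (cauchyVec L d m) = 0 := by
  induction m using Nat.strong_induction_on generalizing d with
  | _ m ih =>
  -- comparison of `d` with the lift of `d₀`, for a level at which `d₀` is known to lie in `N_l`
  have key : ∀ l ≤ m, d 0 ∈ D.N L l → D.P l (cauchyVec L d l) = D.P l (D.A L l (d 0)) := by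
    intro l hl h0
    have e0 : D.E L l 0 (d 0) = d 0 := by rw [E_coeff_zero]; rfl
    have hE := (hD.cauchyVec_lifts (j := l) (by omega)).1 _ h0
    cases l with
    | zero => rw [cauchyVec_at_zero, A_zero_apply]
    | succ l =>
      have hs : ∀ i, cauchyVec L (fun p => d (p + 1) - D.E L (l + 1) (p + 1) (d 0)) i =
          cauchyVec L d (i + 1) - cauchyVec L (fun p => D.E L (l + 1) p (d 0)) (i + 1) := fun i => by
        rw [← cauchyVec_sub, cauchyVec_succ_of_zero L (by simp [e0])]
      have := (ih l (by omega) (by omega) (fun p => d (p + 1) - D.E L (l + 1) (p + 1) (d 0))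
        fun i hi => by rw [hs, hd _ (by omega), hE _ (by omega), sub_zero]).2
      rw [hs, map_sub, sub_eq_zero, ← A_apply] at this
      exact this
  have hN : d 0 ∈ D.N L m := by
    cases m with
    | zero => trivial
    | succ m =>
      have h0 := (ih m (by omega) (by omega) d fun i hi => hd i (by omega)).1
      rw [mem_N_succ_iff]
      refine ⟨h0, ?_⟩
      rw [← key m (by omega) h0, hd m (by omega), map_zero]
  refine ⟨hN, ?_⟩
  rw [← hD.P_P (Nat.le_succ m) (by omega), key m le_rfl hN, hD.P_P (Nat.le_succ m) (by omega),
    hD.P_succ_A hm hN]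

lemma C_mem {j : ℕ} (hj : j ≤ k + 1) {i : ℕ} (hi : i < j) (y : B') :
    D.C L j i y ∈ D.Nc (i + 1) := by
  induction j generalizing y with
  | zero => omega
  | succ j ih =>
    by_cases h : i = j
    · subst h; rw [C_succ_self]; exact hD.V_mem (by omega) y
    · rw [C_succ_of_ne D L h]; exact ih (by omega) (by omega) _

/-- The `C_{j,i}` are coordinates for `ker P_j = R₁ ⊕ … ⊕ R_j`. -/
lemma sum_A_C {j : ℕ} (hj : j ≤ k + 1) {y : B'} (hy : D.P j y = 0) :
    ∑ i ∈ Finset.range j, D.A L i (D.C L j i y) = y := by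
  induction j generalizing y with
  | zero => rw [hD.P_zero] at hy; simp [hy]
  | succ j ih =>
    have h := ih (by omega) (y := y - D.A L j (D.V j y)) (by rw [hD.P_sub_A_V (by omega), hy])
    rw [Finset.sum_range_succ, C_succ_self]
    have e : ∑ i ∈ Finset.range j, D.A L i (D.C L (j + 1) i y) =
        ∑ i ∈ Finset.range j, D.A L i (D.C L j i (y - D.A L j (D.V j y))) :=
      Finset.sum_congr rfl fun i hi => by
        rw [C_succ_of_ne D L (by simpa using (Finset.mem_range.1 hi).ne)]; simp
    rw [e, h, sub_add_cancel]

lemma eq_zero_of_mem_Nc {i : ℕ} (hi : i ≤ k) {x : B} (hx : x ∈ D.Nc (i + 1))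
    (h : D.P i (D.A L i x) = 0) : x = 0 :=
  (Submodule.disjoint_def.1 (hD.N_disjoint i hi)) x hx
    ((D.mem_N_succ_iff L).2 ⟨hD.Nc_le hi hx, h⟩)

lemma V_A {i : ℕ} (hi : i ≤ k) {x : B} (hx : x ∈ D.Nc (i + 1)) : D.V i (D.A L i x) = x := by
  rw [← sub_eq_zero]
  refine hD.eq_zero_of_mem_Nc hi ((D.Nc _).sub_mem (hD.V_mem hi _) hx) ?_
  rw [map_sub, map_sub, hD.P_A_V hi, hD.P_succ_A hi (hD.Nc_le hi hx), sub_zero, sub_self]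

lemma V_eq_zero {i : ℕ} (hi : i ≤ k) {y : B'} (h : D.P i y = 0) : D.V i y = 0 := by
  refine hD.eq_zero_of_mem_Nc hi (hD.V_mem hi _) ?_
  rw [hD.P_A_V hi, h, hD.P_eq_zero_of_le (Nat.le_succ i) (by omega) h, sub_zero]

lemma C_A {m j : ℕ} (hm : m ≤ k + 1) (hj : j < m) (i : ℕ) {x : B} (hx : x ∈ D.Nc (j + 1)) :
    D.C L m i (D.A L j x) = if i = j then x else 0 := by
  induction m with
  | zero => omega
  | succ m ih =>
    rcases Nat.lt_succ_iff_lt_or_eq.1 hj with h | rfl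
    · have h0 : D.V m (D.A L j x) = 0 := hD.V_eq_zero (by omega)
        (hD.P_eq_zero_of_le (i := j + 1) h (by omega)
          (hD.P_succ_A (by omega) (hD.Nc_le (by omega) hx)))
      by_cases hi : i = m
      · subst hi; rw [C_succ_self, h0, if_neg h.ne']
      · rw [C_succ_of_ne D L hi]
        simpa [h0] using ih (by omega) h
    · have h0 := hD.V_A (by omega) hx
      by_cases hi : i = j
      · subst hi; rw [C_succ_self, h0, if_pos rfl]
      · rw [C_succ_of_ne D L hi, if_neg hi]
        simp [h0]

lemma P_last_eq_zero (hS : Function.Surjective (D.sumOp L k)) (y : B') : D.P (k + 1) y = 0 := by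
  obtain ⟨n, rfl⟩ := hS y
  simp only [sumOp, sum_apply, map_sum]
  refine Finset.sum_eq_zero fun i _ => ?_
  exact hD.P_R (k + 1) le_rfl (i + 1) (by omega) _ ⟨(n i : B), (n i).2, rfl⟩

/-- If `L(ε) w(ε) + g(ε) = 0` can be solved up to the order `k - 1`, then `particular` solves it up
to the order `k`. -/
lemma cauchyVec_particular (hS : Function.Surjective (D.sumOp L k)) (g : ℕ → B')
    (w : ℕ → B) (hw : ∀ i < k, cauchyVec L w i + g i = 0) {m : ℕ} (hm : m ≤ k + 1) {i : ℕ}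
    (hi : i < m) : cauchyVec L (D.particular L g m) i + g i = 0 := by
  induction m generalizing i with
  | zero => omega
  | succ m ih =>
    set v := D.particular L g m with hv
    set y : B' := - g m - cauchyVec L v m with hy
    have hPy : D.P (m + 1) y = 0 := by
      rcases (Nat.lt_succ_iff_lt_or_eq.1 hm) with h | h
      · have := (hD.mem_N_and_P_cauchyVec (m := m) (by omega) (fun p => w p - v p) fun i hi => by
          rw [cauchyVec_sub, eq_neg_of_add_eq_zero_left (hw i (by omega)),
            eq_neg_of_add_eq_zero_left (ih (by omega) hi), sub_self]).2
        rwa [cauchyVec_sub, eq_neg_of_add_eq_zero_left (hw m (by omega))] at this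
      · rw [h]; exact hD.P_last_eq_zero hS y
    have e : D.particular L g (m + 1) = fun p => v p + (D.E L m p (D.V m y) +
        D.K L m p (y - D.A L m (D.V m y))) := rfl
    have h1 := (hD.cauchyVec_lifts (j := m) (by omega)).1 _
      (hD.Nc_le (by omega) (hD.V_mem (by omega) y))
    obtain ⟨h2, h3⟩ := (hD.cauchyVec_lifts (j := m) (by omega)).2 (y - D.A L m (D.V m y))
      (by rw [hD.P_sub_A_V (by omega), hPy])
    rw [e, cauchyVec_add, cauchyVec_add]
    rcases Nat.lt_succ_iff_lt_or_eq.1 hi with hi | rfl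
    · rw [h1 i hi, h2 i hi, add_zero, add_zero, ih (by omega) hi]
    · rw [h3, ← A_apply, hy]; abel

end IsDecomposition

end DecompData

end SolutionCurve

/-! ### The operators of the solution formula -/

namespace SolutionCurve

section Triangular

variable {𝕜 : Type*} [RCLike 𝕜] {B : Type*} [NormedAddCommGroup B] [NormedSpace 𝕜 B]

/-- An operator matrix that is upper triangular with identities on the diagonal is invertible. -/
lemma isInvertible_of_strictly_triangular {n : ℕ} (M : (Fin n → B) →L[𝕜] (Fin n → B))
    (h : ∀ (x : Fin n → B) (r : Fin n), (∀ i, r < i → x i = 0) → M x r = x r) :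
    M.IsInvertible := by
  have hnil : ∀ m (x : Fin n → B) (r : Fin n), n ≤ r + m → (((M - 1) ^ m) x) r = 0 := by
    intro m
    induction m with
    | zero => intro x r hr; omega
    | succ m ih =>
      intro x r hr
      rw [pow_succ']
      have := h (((M - 1) ^ m) x) r fun i hi => ih x i (by have := Fin.lt_def.1 hi; omega)
      change M (((M - 1) ^ m) x) r - ((M - 1) ^ m) x r = 0
      rw [this, sub_self]
  have h1 : IsNilpotent (M - 1) := ⟨n, by ext x r; exact hnil n x r (by omega)⟩
  have h2 : IsUnit M := by simpa using h1.isUnit_one_add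
  exact ⟨ContinuousLinearEquiv.unitsEquiv 𝕜 _ h2.unit, rfl⟩

end Triangular

namespace DecompData

variable {𝕜 : Type*} [RCLike 𝕜] {B B' : Type*}
  [NormedAddCommGroup B] [NormedSpace 𝕜 B] [NormedAddCommGroup B'] [NormedSpace 𝕜 B']
  (D : DecompData 𝕜 B B') (L : ℕ → B →L[𝕜] B') (k : ℕ)

/-- The coefficient of `εᵖ` in the curve `∑ᵢ ε^(k-i) E_i(ε) uᵢ`, where `uᵢ = xᵢ / (2k+1-i)!`. -/
def liftCurve (x : Fin (k + 1) → B) (p : ℕ) : B :=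
  ∑ i : Fin (k + 1), if k - i ≤ p then
    D.E L i (p - (k - i)) ((1 / (Nat.factorial (2 * k + 1 - i) : 𝕜)) • x i) else 0

lemma Mhat_apply (x : Fin (k + 1) → B) (r : Fin (k + 1)) :
    D.Mhat L k x r = (Nat.factorial (2 * k + 1 - r) : 𝕜) • D.liftCurve L k x (k - r) := by
  simp only [Mhat, liftCurve, ContinuousLinearMap.pi_apply, sum_apply, Finset.smul_sum]
  refine Finset.sum_congr rfl fun i _ => ?_
  by_cases h : r ≤ i
  · have h' : (r : ℕ) ≤ i := h
    have e : k - (r : ℕ) - (k - i) = i - r := by omega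
    rw [if_pos h, if_pos (by omega), e, map_smul, smul_smul, mul_one_div]
    simp
  · have h' : ¬ (r : ℕ) ≤ i := h
    rw [if_neg h, if_neg (by omega), smul_zero]; simp

lemma Mhat_isInvertible : (D.Mhat L k).IsInvertible := by
  refine isInvertible_of_strictly_triangular _ fun x r hx => ?_
  simp only [Mhat, ContinuousLinearMap.pi_apply, sum_apply]
  rw [Finset.sum_eq_single r]
  · have : (Nat.factorial (2 * k + 1 - r) : 𝕜) ≠ 0 := by
      exact_mod_cast Nat.factorial_ne_zero _
    simp [E_coeff_zero, this]
  · intro i _ hi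
    split_ifs with h
    · simp [hx i (lt_of_le_of_ne h hi.symm)]
    · simp
  · simp

lemma Lhat_apply (x : Fin (k + 1) → B) (i : Fin (k + 1)) :
    D.Lhat L k x i = x i - ∑ j : Fin (k + 1), if i < j then
      ((Nat.factorial (2 * k + 1 - i) : 𝕜) / (Nat.factorial (2 * k + 1 - j) : 𝕜)) •
        D.C L j i (D.A L j (x j)) else 0 := by
  simp only [Lhat, ContinuousLinearMap.pi_apply, sum_apply, sub_apply]
  refine congrArg₂ _ rfl (Finset.sum_congr rfl fun j _ => ?_)
  split_ifs <;> simp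

lemma Lhat_isInvertible : (D.Lhat L k).IsInvertible := by
  refine isInvertible_of_strictly_triangular _ fun x r hx => ?_
  rw [Lhat_apply, Finset.sum_eq_zero, sub_zero]
  intro j _
  split_ifs with h
  · simp [hx j h]
  · rfl

/-- The bounded operator `y ↦ (n₁ᶜ, …, n_{k+1}ᶜ)` inverse to `nᶜ ↦ ∑ᵢ Aᵢ nᶜᵢ₊₁ / (2k+1-i)!`. -/
def ncOf : B' →L[𝕜] (Fin (k + 1) → B) :=
  ContinuousLinearMap.pi fun i => (Nat.factorial (2 * k + 1 - i) : 𝕜) • D.C L (k + 1) i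

/-- The operator `(y, n) ↦ nᶜ + L̂ n`. -/
def inputOf : (B' × (Fin (k + 1) → B)) →L[𝕜] (Fin (k + 1) → B) :=
  (D.ncOf L k).coprod (D.Lhat L k)

/-- `liftCurve` as a bounded operator. -/
def liftCurveL (p : ℕ) : (Fin (k + 1) → B) →L[𝕜] B :=
  ∑ i : Fin (k + 1), if k - i ≤ p then
    (D.E L i (p - (k - i))).comp
      ((1 / (Nat.factorial (2 * k + 1 - i) : 𝕜)) • ContinuousLinearMap.proj i) else 0

lemma liftCurveL_apply (p : ℕ) (x : Fin (k + 1) → B) :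
    D.liftCurveL L k p x = D.liftCurve L k x p := by
  simp only [liftCurveL, liftCurve, sum_apply]
  refine Finset.sum_congr rfl fun i _ => ?_
  split_ifs <;> simp

namespace IsDecomposition

variable {D L} {k : ℕ} (hD : D.IsDecomposition L k)
include hD

/-- `L(ε) ∑ᵢ ε^(k-i) E_i(ε) uᵢ = εᵏ ∑ᵢ Aᵢ uᵢ + O(ε^(k+1))` if `uᵢ ∈ Nᵢ`. -/
lemma cauchyVec_liftCurve {x : Fin (k + 1) → B} (hx : ∀ i : Fin (k + 1), x i ∈ D.N L i) {m : ℕ}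
    (hm : m ≤ k) : cauchyVec L (D.liftCurve L k x) m = if m = k then
      ∑ i : Fin (k + 1), D.A L i ((1 / (Nat.factorial (2 * k + 1 - i) : 𝕜)) • x i) else 0 := by
  have e : D.liftCurve L k x = fun p => ∑ i : Fin (k + 1), if k - i ≤ p then
    D.E L i (p - (k - i)) ((1 / (Nat.factorial (2 * k + 1 - i) : 𝕜)) • x i) else 0 := rfl
  rw [e, cauchyVec_sum]
  have h : ∀ i : Fin (k + 1), cauchyVec L (fun p => if k - i ≤ p then
      D.E L i (p - (k - i)) ((1 / (Nat.factorial (2 * k + 1 - i) : 𝕜)) • x i) else 0) m =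
      if m = k then D.A L i ((1 / (Nat.factorial (2 * k + 1 - i) : 𝕜)) • x i) else 0 := by
    intro i
    have hu : (1 / (Nat.factorial (2 * k + 1 - i) : 𝕜)) • x i ∈ D.N L i :=
      (D.N L i).smul_mem _ (hx i)
    have hi := i.2
    rw [cauchyVec_shift L (k - i)
      (fun p => D.E L i p ((1 / (Nat.factorial (2 * k + 1 - i) : 𝕜)) • x i)) m]
    split_ifs with h1 h2 h2
    · rw [A_apply, h2, show k - (k - (i : ℕ)) = i by omega]
    · exact (hD.cauchyVec_lifts (j := i) (by omega)).1 _ hu _ (by omega)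
    · omega
    · rfl
  simp only [h]
  split_ifs <;> simp

lemma Lhat_mem {n : Fin (k + 1) → B} (hn : ∀ i : Fin (k + 1), n i ∈ D.N L (i + 1))
    (i : Fin (k + 1)) : D.Lhat L k n i ∈ D.N L i := by
  rw [Lhat_apply]
  refine (D.N L i).sub_mem (D.N_succ_le L i (hn i)) ((D.N L i).sum_mem fun j _ => ?_)
  have hi := i.2
  have hj := j.2
  split_ifs with h
  · exact (D.N L i).smul_mem _ (hD.Nc_le (by omega) (hD.C_mem (by omega) h _))
  · exact (D.N L i).zero_mem

/-- The role of `L̂`: the free parameters `n` do not contribute to the leading coefficient, since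
`A_j n_{j+1} = ∑_{i<j} A_i C_{j,i} A_j n_{j+1}`. -/
lemma sum_A_Lhat {n : Fin (k + 1) → B} (hn : ∀ i : Fin (k + 1), n i ∈ D.N L (i + 1)) :
    ∑ i : Fin (k + 1), D.A L i ((1 / (Nat.factorial (2 * k + 1 - i) : 𝕜)) • D.Lhat L k n i) = 0 := by
  have hf : ∀ i : ℕ, (Nat.factorial i : 𝕜) ≠ 0 := fun i => by
    exact_mod_cast Nat.factorial_ne_zero i
  have e : ∀ i : Fin (k + 1),
      D.A L i ((1 / (Nat.factorial (2 * k + 1 - i) : 𝕜)) • D.Lhat L k n i) =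
      (1 / (Nat.factorial (2 * k + 1 - i) : 𝕜)) • D.A L i (n i) - ∑ j : Fin (k + 1), if i < j then
        (1 / (Nat.factorial (2 * k + 1 - j) : 𝕜)) • D.A L i (D.C L j i (D.A L j (n j))) else 0 := by
    intro i
    rw [Lhat_apply, smul_sub, map_sub, map_smul, Finset.smul_sum, map_sum]
    refine congrArg₂ _ rfl (Finset.sum_congr rfl fun j _ => ?_)
    split_ifs
    · rw [smul_smul, map_smul]
      congr 1
      have := hf (2 * k + 1 - i)
      field_simp
    · simp
  simp only [e]
  rw [Finset.sum_sub_distrib, sub_eq_zero, Finset.sum_comm]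
  refine Finset.sum_congr rfl fun j _ => ?_
  have hj := j.2
  have h := hD.sum_A_C (j := j) (by omega) ((D.mem_N_succ_iff L).1 (hn j)).2
  rw [← Finset.sum_filter, ← Finset.smul_sum]
  congr 1
  conv_lhs => rw [← h]
  refine (Finset.sum_bij (s := Finset.univ.filter (· < j))
    (f := fun i : Fin (k + 1) => D.A L i (D.C L j i (D.A L j (n j))))
    (fun i _ => (i : ℕ)) ?_ ?_ ?_ ?_).symm
  · intro i hi; simpa using hi
  · intro a _ b _ hab; exact Fin.ext hab
  · intro b hb
    have hb' := Finset.mem_range.1 hb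
    exact ⟨⟨b, by omega⟩, Finset.mem_filter.2 ⟨Finset.mem_univ _, Fin.lt_def.2 hb'⟩, rfl⟩
  · intro i _; rfl

lemma ncOf_mem (y : B') (i : Fin (k + 1)) : D.ncOf L k y i ∈ D.Nc (i + 1) :=
  (D.Nc (i + 1)).smul_mem _ (hD.C_mem le_rfl i.2 y)

lemma inputOf_mem (y : B') {n : Fin (k + 1) → B} (hn : ∀ i : Fin (k + 1), n i ∈ D.N L (i + 1))
    (i : Fin (k + 1)) : D.inputOf L k (y, n) i ∈ D.N L i :=
  (D.N L i).add_mem (hD.Nc_le (Nat.lt_succ_iff.1 i.2) (hD.ncOf_mem y i)) (hD.Lhat_mem hn i)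

lemma sum_A_inputOf (hS : Function.Surjective (D.sumOp L k)) (y : B') {n : Fin (k + 1) → B}
    (hn : ∀ i : Fin (k + 1), n i ∈ D.N L (i + 1)) :
    ∑ i : Fin (k + 1), D.A L i
      ((1 / (Nat.factorial (2 * k + 1 - i) : 𝕜)) • D.inputOf L k (y, n) i) = y := by
  have hf : ∀ i : ℕ, (Nat.factorial i : 𝕜) ≠ 0 := fun i => by
    exact_mod_cast Nat.factorial_ne_zero i
  have e : ∀ i : Fin (k + 1), D.A L i
      ((1 / (Nat.factorial (2 * k + 1 - i) : 𝕜)) • D.inputOf L k (y, n) i) =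
      D.A L i (D.C L (k + 1) i y) +
      D.A L i ((1 / (Nat.factorial (2 * k + 1 - i) : 𝕜)) • D.Lhat L k n i) := fun i => by
    rw [← map_add]
    congr 1
    simp [inputOf, ncOf, smul_smul, inv_mul_cancel₀ (hf _)]
  simp only [e]
  rw [Finset.sum_add_distrib, hD.sum_A_Lhat hn, add_zero,
    Fin.sum_univ_eq_sum_range (fun i => D.A L i (D.C L (k + 1) i y)),
    hD.sum_A_C le_rfl (hD.P_last_eq_zero hS y)]

/-- The coefficients `w_p` of the solution curve satisfy the equations of order `< k` for all
parameters, and the residual in the equation of order `k` is `y`. -/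
lemma cauchyVec_particular_add_liftCurve (hS : Function.Surjective (D.sumOp L k)) (g : ℕ → B')
    (w : ℕ → B) (hw : ∀ i < k, cauchyVec L w i + g i = 0) (y : B') {n : Fin (k + 1) → B}
    (hn : ∀ i : Fin (k + 1), n i ∈ D.N L (i + 1)) {m : ℕ} (hm : m ≤ k) :
    cauchyVec L (fun p => D.particular L g (k + 1) p + D.liftCurve L k (D.inputOf L k (y, n)) p) m
      + g m = if m = k then y else 0 := by
  rw [cauchyVec_add, hD.cauchyVec_liftCurve (hD.inputOf_mem y hn) hm, hD.sum_A_inputOf hS y hn,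
    add_right_comm, hD.cauchyVec_particular hS g w hw le_rfl (by omega), zero_add]

end IsDecomposition

end DecompData

end SolutionCurve

/-! ### Expansion of the equation along the leading curve -/

namespace SolutionCurve

section Expansion

variable {𝕜 : Type*} [RCLike 𝕜] {B B' : Type*}
  [NormedAddCommGroup B] [NormedSpace 𝕜 B] [NormedAddCommGroup B'] [NormedSpace 𝕜 B']

lemma curve_zero (n : ℕ) (z : ℕ → B) : curve 𝕜 n z 0 = 0 := by
  refine Finset.sum_eq_zero fun i hi => ?_
  have : i ≠ 0 := by have := (Finset.mem_Icc.1 hi).1; omega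
  simp [this]

lemma contDiff_curve (n : ℕ) (z : ℕ → B) : ContDiff 𝕜 ω (curve 𝕜 n z) := by
  unfold curve
  fun_prop

lemma curve_congr {n : ℕ} {z z' : ℕ → B} (h : ∀ i ∈ Finset.Icc 1 n, z i = z' i) (ε : 𝕜) :
    curve 𝕜 n z ε = curve 𝕜 n z' ε :=
  Finset.sum_congr rfl fun i hi => by rw [h i hi]

lemma curve_add (m c : ℕ) (z : ℕ → B) (ε : 𝕜) : curve 𝕜 (m + c) z ε = curve 𝕜 m z ε +
    ε ^ (m + 1) • ∑ p ∈ Finset.range c,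
      ε ^ p • ((1 / (Nat.factorial (m + 1 + p) : 𝕜)) • z (m + 1 + p)) := by
  induction c with
  | zero => simp
  | succ c ih =>
    rw [Finset.sum_range_succ, smul_add, ← add_assoc (curve 𝕜 m z ε), ← ih, curve,
      ← add_assoc m c 1, Finset.sum_Icc_succ_top (by omega), ← curve, smul_smul, smul_smul,
      ← pow_add]
    congr 2
    · rw [show m + c + 1 = m + 1 + c by ring, mul_one_div]
    · rw [show m + c + 1 = m + 1 + c by ring]

/-- A polynomial expansion with analytic remainder gives the derivatives at `0`. -/
lemma iteratedDeriv_of_expansion [CompleteSpace B'] {f R : 𝕜 → B'} {N : ℕ} {c : ℕ → B'}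
    (hR : AnalyticAt 𝕜 R 0)
    (h : ∀ᶠ ε in 𝓝 0, f ε = ∑ i ∈ Finset.range N, ε ^ i • c i + ε ^ N • R ε) {m : ℕ} (hm : m < N) :
    iteratedDeriv m f 0 = (Nat.factorial m : 𝕜) • c m := by
  have hrem : AnalyticAt 𝕜 (fun ε => ε ^ N • R ε) 0 := by fun_prop
  have hpol : AnalyticAt 𝕜 (fun ε : 𝕜 => ∑ i ∈ Finset.range N, ε ^ i • c i) 0 :=
    Finset.analyticAt_fun_sum _ fun i _ => by fun_prop
  have h0 : iteratedDeriv m (fun ε => ε ^ N • R ε) 0 = 0 :=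
    (natCast_le_analyticOrderAt_iff_iteratedDeriv_eq_zero hrem).1
      ((natCast_le_analyticOrderAt hrem).2 ⟨R, hR, by simp⟩) m hm
  rw [Filter.EventuallyEq.iteratedDeriv_eq m h,
    iteratedDeriv_fun_add hpol.contDiffAt hrem.contDiffAt, h0, add_zero]
  simp (disch := fun_prop) only [iteratedDeriv_fun_sum, iteratedDeriv_smul_const,
    iteratedDeriv_fun_pow_zero]
  simp [ite_smul, Finset.sum_ite_eq_of_mem _ _ _ (Finset.mem_range.mpr hm)]

/-- `Tᵐ` may be computed along the curve with any number `n ≥ m` of terms. -/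
lemma T_eq_iteratedDeriv [CompleteSpace B'] {G : B → B'} (hG : AnalyticAt 𝕜 G 0) (m c : ℕ)
    (z : ℕ → B) :
    T 𝕜 G m z = iteratedDeriv m (fun ε : 𝕜 => G (curve 𝕜 (m + c) z ε)) 0 := by
  obtain ⟨q, hq, h⟩ := exists_analyticAt_diffQuot hG
  let r : 𝕜 → B := fun ε => ∑ p ∈ Finset.range c,
      ε ^ p • ((1 / (Nat.factorial (m + 1 + p) : 𝕜)) • z (m + 1 + p))
  have hr : ContDiff 𝕜 ω r := by fun_prop
  let γ : 𝕜 → B × B := fun ε => (curve 𝕜 m z ε, ε ^ (m + 1) • r ε)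
  have hγ : ContDiff 𝕜 ω γ := (contDiff_curve m z).prodMk (by fun_prop)
  have hγ0 : γ 0 = 0 := by simp [γ, curve_zero]
  have hγa : AnalyticAt 𝕜 γ 0 := hγ.contDiffAt.analyticAt
  have hqa : AnalyticAt 𝕜 (fun ε => q (γ ε)) 0 := AnalyticAt.comp (by rwa [hγ0]) hγa
  have hR : AnalyticAt 𝕜 (fun ε => q (γ ε) (r ε)) 0 :=
    (hqa.contDiffAt.clm_apply hr.contDiffAt (n := ω)).analyticAt
  have hGm : AnalyticAt 𝕜 (fun ε => G (curve 𝕜 m z ε)) 0 :=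
    AnalyticAt.comp (by rwa [curve_zero]) (contDiff_curve m z).contDiffAt.analyticAt
  have hrem : AnalyticAt 𝕜 (fun ε => ε ^ (m + 1) • q (γ ε) (r ε)) 0 :=
    (analyticAt_id.pow _).smul hR
  have h0 : iteratedDeriv m (fun ε => ε ^ (m + 1) • q (γ ε) (r ε)) 0 = 0 :=
    (natCast_le_analyticOrderAt_iff_iteratedDeriv_eq_zero hrem).1
      ((natCast_le_analyticOrderAt hrem).2 ⟨_, hR, by simp⟩) m (Nat.lt_succ_self m)
  have he : (fun ε : 𝕜 => G (curve 𝕜 (m + c) z ε)) =ᶠ[𝓝 0]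
      fun ε => G (curve 𝕜 m z ε) + ε ^ (m + 1) • q (γ ε) (r ε) := by
    filter_upwards [(hγ.continuous.tendsto' 0 0 hγ0).eventually h] with ε hε
    rw [curve_add]
    refine Eq.trans hε ?_
    change _ + q (γ ε) (ε ^ (m + 1) • r ε) = _
    rw [map_smul]
  rw [he.iteratedDeriv_eq m, iteratedDeriv_fun_add hGm.contDiffAt hrem.contDiffAt, h0, add_zero]
  rfl

/-- The part of order `≥ K` of the product of the polynomials `∑_{j<K} εʲ L_j` and
`∑_{p<K} εᵖ w_p`, divided by `εᴷ`. -/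
def productRem (L : ℕ → B →L[𝕜] B') (K : ℕ) (ε : 𝕜) (w : ℕ → B) : B' :=
  ∑ j ∈ Finset.range K, ∑ p ∈ Finset.range K,
    if K ≤ j + p then ε ^ (j + p - K) • L j (w p) else 0

lemma productRem_smul (L : ℕ → B →L[𝕜] B') (K : ℕ) (ε s : 𝕜) (w : ℕ → B) :
    productRem L K ε (fun p => s • w p) = s • productRem L K ε w := by
  simp only [productRem, Finset.smul_sum]
  refine Finset.sum_congr rfl fun j _ => Finset.sum_congr rfl fun p _ => ?_
  split_ifs
  · rw [map_smul, smul_comm]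
  · simp

lemma sum_pow_smul_apply_sum (L : ℕ → B →L[𝕜] B') (K : ℕ) (ε : 𝕜) (w : ℕ → B) :
    ∑ j ∈ Finset.range K, ε ^ j • L j (∑ p ∈ Finset.range K, ε ^ p • w p) =
      ∑ m ∈ Finset.range K, ε ^ m • cauchyVec L w m + ε ^ K • productRem L K ε w := by
  have e1 : ∑ m ∈ Finset.range K, ε ^ m • cauchyVec L w m =
      ∑ j ∈ Finset.range K, ∑ p ∈ Finset.range K,
        if j + p < K then ε ^ (j + p) • L j (w p) else 0 := by
    simp only [cauchyVec, Finset.smul_sum]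
    rw [Finset.sum_sigma', ← Finset.sum_product', ← Finset.sum_filter]
    refine Finset.sum_nbij' (fun x => (x.1 - x.2, x.2)) (fun x => ⟨x.1 + x.2, x.2⟩) ?_ ?_ ?_ ?_ ?_
    · rintro ⟨m, q⟩ h
      simp only [Finset.mem_sigma, Finset.mem_range, Finset.mem_filter, Finset.mem_product] at h ⊢
      omega
    · rintro ⟨m, q⟩ h
      simp only [Finset.mem_sigma, Finset.mem_range, Finset.mem_filter, Finset.mem_product] at h ⊢
      omega
    · rintro ⟨m, q⟩ h
      simp only [Finset.mem_sigma, Finset.mem_range] at h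
      simp only [Sigma.mk.injEq, heq_eq_eq, and_true]
      omega
    · rintro ⟨m, q⟩ h
      simp
    · rintro ⟨m, q⟩ h
      simp only [Finset.mem_sigma, Finset.mem_range] at h
      simp only [show m - q + q = m by omega]
  rw [e1, productRem, Finset.smul_sum, ← Finset.sum_add_distrib]
  refine Finset.sum_congr rfl fun j _ => ?_
  rw [Finset.smul_sum, ← Finset.sum_add_distrib, map_sum, Finset.smul_sum]
  refine Finset.sum_congr rfl fun p _ => ?_
  rw [map_smul, smul_smul, ← pow_add]
  split_ifs with h1 h2 h2
  · omega
  · simp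
  · rw [smul_smul, ← pow_add, Nat.add_sub_cancel' h2, zero_add]
  · omega

/-- The expansion of `G` near the curve `z̄(ε)` with the Taylor polynomials of the value and the
linearization along the curve, and analytic remainders. -/
lemma exists_expansion [CompleteSpace B'] {G : B → B'} (hG : AnalyticAt 𝕜 G 0) (k : ℕ)
    (zb : ℕ → B) :
    ∃ (gr : 𝕜 → B') (Lr : 𝕜 → B →L[𝕜] B') (q : 𝕜 × B → B →L[𝕜] B →L[𝕜] B'),
      ContDiffAt 𝕜 ω gr 0 ∧ ContDiffAt 𝕜 ω Lr 0 ∧ ContDiffAt 𝕜 ω q 0 ∧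
      (∀ᶠ ε in 𝓝 (0 : 𝕜), fderiv 𝕜 G (curve 𝕜 k zb ε) =
        ∑ j ∈ Finset.range (k + 1), ε ^ j • linCoeff 𝕜 G k zb j + ε ^ (k + 1) • Lr ε) ∧
      ∀ᶠ x : 𝕜 × B in 𝓝 0, G (curve 𝕜 k zb x.1 + x.2) =
        (∑ i ∈ Finset.range (2 * k + 2), x.1 ^ i • valCoeff 𝕜 G k zb i +
          x.1 ^ (2 * k + 2) • gr x.1) +
        (∑ j ∈ Finset.range (k + 1), x.1 ^ j • linCoeff 𝕜 G k zb j x.2 +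
          x.1 ^ (k + 1) • Lr x.1 x.2) + q x x.2 x.2 := by
  have hc : AnalyticAt 𝕜 (curve 𝕜 k zb) 0 := (contDiff_curve k zb).contDiffAt.analyticAt
  have hGc : AnalyticAt 𝕜 (fun ε : 𝕜 => G (curve 𝕜 k zb ε)) 0 :=
    AnalyticAt.comp (by rwa [curve_zero]) hc
  have hLc : AnalyticAt 𝕜 (fun ε : 𝕜 => fderiv 𝕜 G (curve 𝕜 k zb ε)) 0 :=
    AnalyticAt.comp (by rw [curve_zero]; exact hG.fderiv) hc
  obtain ⟨gr, hgr, hg⟩ := hGc.exists_eventuallyEq_sum_add_pow_mul (2 * k + 2)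
  obtain ⟨Lr, hLr, hl⟩ := hLc.exists_eventuallyEq_sum_add_pow_mul (k + 1)
  obtain ⟨q, hq, hq'⟩ := exists_analyticAt_taylor_two hG
  have hl' : ∀ᶠ ε in 𝓝 (0 : 𝕜), fderiv 𝕜 G (curve 𝕜 k zb ε) =
      ∑ j ∈ Finset.range (k + 1), ε ^ j • linCoeff 𝕜 G k zb j + ε ^ (k + 1) • Lr ε := by
    filter_upwards [hl] with ε hε
    rw [hε]
    congr 1
    refine Finset.sum_congr rfl fun j _ => ?_
    rw [linCoeff, smul_smul, mul_one_div]
  let γ : 𝕜 × B → B × B := fun x => (curve 𝕜 k zb x.1, x.2)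
  have hγ : ContDiff 𝕜 ω γ := ((contDiff_curve k zb).comp contDiff_fst).prodMk contDiff_snd
  have hγ0 : γ 0 = 0 := by simp [γ, curve_zero]
  refine ⟨gr, Lr, fun x => q (γ x), hgr.contDiffAt, hLr.contDiffAt,
    ContDiffAt.comp (0 : 𝕜 × B) (by rwa [hγ0]) hγ.contDiffAt, hl', ?_⟩
  have hfst : Tendsto (Prod.fst : 𝕜 × B → 𝕜) (𝓝 0) (𝓝 0) := continuous_fst.tendsto' _ _ rfl
  filter_upwards [hfst.eventually hg, hfst.eventually hl',
    (hγ.continuous.tendsto' 0 0 hγ0).eventually hq'] with x h1 h2 h3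
  have h3' : G (curve 𝕜 k zb x.1 + x.2) = G (curve 𝕜 k zb x.1) +
    fderiv 𝕜 G (curve 𝕜 k zb x.1) x.2 + q (γ x) x.2 x.2 := h3
  rw [h3', h2, h1]
  congr 2
  · congr 1
    refine Finset.sum_congr rfl fun j _ => ?_
    rw [valCoeff, smul_smul, mul_one_div]
  · simp [sum_apply]

/-- The coefficient of `εᵐ` in `G(z̄(ε) + ε^(k+1) (w₀ + ε w₁ + …))`, for `m ≤ 2k+1`. -/
def residual (G : B → B') (k : ℕ) (zb : ℕ → B) (w : ℕ → B) (m : ℕ) : B' :=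
  valCoeff 𝕜 G k zb m +
    if k + 1 ≤ m then cauchyVec (linCoeff 𝕜 G k zb) w (m - (k + 1)) else 0

/-- Expansion of `G` along `z̄(ε) + ε^(k+1) w(ε)`: since `w` enters quadratically only at the order
`2k+2`, the coefficients up to the order `2k+1` are affine in `w`. -/
lemma expansion_along {G : B → B'} {k : ℕ} {zb : ℕ → B} {gr : 𝕜 → B'} {Lr : 𝕜 → B →L[𝕜] B'}
    {q : 𝕜 × B → B →L[𝕜] B →L[𝕜] B'} {ε : 𝕜} {w : ℕ → B} {W : B}
    (hW : W = ∑ p ∈ Finset.range (k + 1), ε ^ p • w p)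
    (h : G (curve 𝕜 k zb ε + ε ^ (k + 1) • W) =
        (∑ i ∈ Finset.range (2 * k + 2), ε ^ i • valCoeff 𝕜 G k zb i +
          ε ^ (2 * k + 2) • gr ε) +
        (∑ j ∈ Finset.range (k + 1), ε ^ j • linCoeff 𝕜 G k zb j (ε ^ (k + 1) • W) +
          ε ^ (k + 1) • Lr ε (ε ^ (k + 1) • W)) +
        q (ε, ε ^ (k + 1) • W) (ε ^ (k + 1) • W) (ε ^ (k + 1) • W)) :
    G (curve 𝕜 k zb ε + ε ^ (k + 1) • W) =
      ∑ m ∈ Finset.range (2 * k + 2), ε ^ m • residual (𝕜 := 𝕜) G k zb w m +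
      ε ^ (2 * k + 2) • (gr ε + productRem (linCoeff 𝕜 G k zb) (k + 1) ε w + Lr ε W +
        q (ε, ε ^ (k + 1) • W) W W) := by
  have e1 : ∑ j ∈ Finset.range (k + 1), ε ^ j • linCoeff 𝕜 G k zb j (ε ^ (k + 1) • W) =
      ε ^ (k + 1) • (∑ m ∈ Finset.range (k + 1), ε ^ m • cauchyVec (linCoeff 𝕜 G k zb) w m +
        ε ^ (k + 1) • productRem (linCoeff 𝕜 G k zb) (k + 1) ε w) := by
    rw [← sum_pow_smul_apply_sum, ← hW, Finset.smul_sum]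
    refine Finset.sum_congr rfl fun j _ => ?_
    rw [map_smul, smul_comm]
  have e2 : ∑ m ∈ Finset.range (2 * k + 2), ε ^ m • residual (𝕜 := 𝕜) G k zb w m =
      ∑ i ∈ Finset.range (2 * k + 2), ε ^ i • valCoeff 𝕜 G k zb i +
      ε ^ (k + 1) • ∑ m ∈ Finset.range (k + 1), ε ^ m • cauchyVec (linCoeff 𝕜 G k zb) w m := by
    simp only [residual, smul_add, Finset.sum_add_distrib]
    congr 1
    rw [show 2 * k + 2 = (k + 1) + (k + 1) by ring, Finset.sum_range_add, Finset.sum_eq_zero,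
      zero_add, Finset.smul_sum]
    · refine Finset.sum_congr rfl fun m _ => ?_
      rw [if_pos (by omega), smul_smul, ← pow_add, Nat.add_sub_cancel_left]
    · intro m hm
      have := Finset.mem_range.1 hm
      rw [if_neg (by omega), smul_zero]
  have e3 : ε ^ (2 * k + 2) = ε ^ (k + 1) * ε ^ (k + 1) := by ring
  rw [h, e1, e2, e3]
  simp only [map_smul, smul_add, smul_smul, FunLike.coe_smul, Pi.smul_apply]
  abel

/-- The equations `Tᵐ = 0`, `m ≤ 2k+1`, for sequences with leading terms `z̄₁, …, z̄ₖ`. -/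
lemma T_eq_residual [CompleteSpace B'] {G : B → B'} (hG : AnalyticAt 𝕜 G 0) {k : ℕ}
    {zb z : ℕ → B} (hz : ∀ i ∈ Finset.Icc 1 k, z i = zb i) {m : ℕ} (hm : m ≤ 2 * k + 1) :
    T 𝕜 G m z = (Nat.factorial m : 𝕜) • residual (𝕜 := 𝕜) G k zb
      (fun p => (1 / (Nat.factorial (k + 1 + p) : 𝕜)) • z (k + 1 + p)) m := by
  obtain ⟨gr, Lr, q, hgr, hLr, hq, -, h⟩ := exists_expansion hG k zb
  set w : ℕ → B := fun p => (1 / (Nat.factorial (k + 1 + p) : 𝕜)) • z (k + 1 + p) with hw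
  let W : 𝕜 → B := fun ε => ∑ p ∈ Finset.range (k + 1), ε ^ p • w p
  have hW : ContDiff 𝕜 ω W := by fun_prop
  let γ : 𝕜 → 𝕜 × B := fun ε => (ε, ε ^ (k + 1) • W ε)
  have hγ : ContDiff 𝕜 ω γ := by fun_prop
  have hγ0 : γ 0 = 0 := by simp [γ]
  have hqγ : ContDiffAt 𝕜 ω (fun ε => q (γ ε)) 0 :=
    ContDiffAt.comp (0 : 𝕜) (by rwa [hγ0]) hγ.contDiffAt
  have hR : ContDiffAt 𝕜 ω (fun ε => gr ε + productRem (linCoeff 𝕜 G k zb) (k + 1) ε w +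
      Lr ε (W ε) + q (γ ε) (W ε) (W ε)) 0 := by
    refine ((hgr.add ?_).add (hLr.clm_apply hW.contDiffAt)).add
      ((hqγ.clm_apply hW.contDiffAt).clm_apply hW.contDiffAt)
    refine ContDiffAt.sum fun j _ => ContDiffAt.sum fun p _ => ?_
    split_ifs
    · fun_prop
    · fun_prop
  rw [show T 𝕜 G m z = iteratedDeriv m (fun ε : 𝕜 => G (curve 𝕜 (2 * k + 1) z ε)) 0 by
    rw [T_eq_iteratedDeriv hG m (2 * k + 1 - m) z, Nat.add_sub_cancel' hm]]
  refine iteratedDeriv_of_expansion (N := 2 * k + 2) hR.analyticAt ?_ (by omega)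
  filter_upwards [(hγ.continuous.tendsto' 0 0 hγ0).eventually h] with ε hε
  rw [show 2 * k + 1 = k + (k + 1) by ring, curve_add, curve_congr hz]
  exact expansion_along rfl hε

end Expansion

end SolutionCurve

/-! ### The solution family -/

namespace SolutionCurve

section Existence

variable {𝕜 : Type*} [RCLike 𝕜] {B B' X : Type*}
  [NormedAddCommGroup B] [NormedSpace 𝕜 B] [NormedAddCommGroup B'] [NormedSpace 𝕜 B']
  [NormedAddCommGroup X] [NormedSpace 𝕜 X]

/-- The solution family, for coefficients `w_p = b_p + Λ_p (y, n)` that satisfy the equations up to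
the order `2k` and leave the residual `y` at the order `2k+1`. -/
lemma exists_solution_family [CompleteSpace B'] [CompleteSpace X] {G : B → B'}
    (hG : AnalyticAt 𝕜 G 0) {k : ℕ} {zb : ℕ → B} (b : ℕ → B) (Λ : ℕ → (B' × X) →L[𝕜] B)
    (hres : ∀ y n, ∀ m ≤ 2 * k + 1,
      residual (𝕜 := 𝕜) G k zb (fun p => b p + Λ p (y, n)) m = if m = 2 * k + 1 then y else 0) :
    ∃ y : 𝕜 → X → B', (∀ n, y 0 n = 0) ∧ ∀ C : ℝ, 0 < C → ∃ ε₀ : ℝ, 0 < ε₀ ∧ ∃ M : ℝ,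
      ContDiffOn 𝕜 ∞ (Function.uncurry y) {q | ‖q.1‖ < ε₀ ∧ ‖q.2‖ < C} ∧
      ∀ ε n, ‖ε‖ < ε₀ → ‖n‖ < C →
        ‖∑ p ∈ Finset.range (k + 1), ε ^ p • (b p + Λ p (y ε n, n))‖ ≤ M ∧
        G (curve 𝕜 k zb ε + ε ^ (k + 1) •
          ∑ p ∈ Finset.range (k + 1), ε ^ p • (b p + Λ p (y ε n, n))) = 0 := by
  obtain ⟨gr, Lr, q, hgr, hLr, hq, -, hexp⟩ := exists_expansion hG k zb
  set L := linCoeff 𝕜 G k zb with hL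
  let W : 𝕜 → X → B' → B := fun ε n y => ∑ p ∈ Finset.range (k + 1), ε ^ p • (b p + Λ p (y, n))
  let Q : 𝕜 → X → B' → B' := fun ε n y =>
    gr ε + productRem L (k + 1) ε (fun p => b p + Λ p (y, n)) + Lr ε (W ε n y) +
      q (ε, ε ^ (k + 1) • W ε n y) (W ε n y) (W ε n y)
  -- the rescaled coefficients `s w_p` and their sum `s W`, at `n = s⁻¹ m`
  let w₁ : (𝕜 × 𝕜 × X) × B' → ℕ → B := fun v p => v.1.1 • b p + Λ p (v.1.1 • v.2, v.1.2.2)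
  let W₁ : (𝕜 × 𝕜 × X) × B' → B := fun v =>
    ∑ p ∈ Finset.range (k + 1), (v.1.1 ^ 2 * v.1.2.1) ^ p • w₁ v p
  let H : (𝕜 × 𝕜 × X) × B' → B' := fun v =>
    v.2 + (v.1.1 ^ 2 * v.1.2.1) • gr (v.1.1 ^ 2 * v.1.2.1) +
      (v.1.1 * v.1.2.1) • productRem L (k + 1) (v.1.1 ^ 2 * v.1.2.1) (w₁ v) +
      (v.1.1 * v.1.2.1) • Lr (v.1.1 ^ 2 * v.1.2.1) (W₁ v) +
      v.1.2.1 • q (v.1.1 ^ 2 * v.1.2.1, (v.1.1 ^ (2 * k + 1) * v.1.2.1 ^ (k + 1)) • W₁ v)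
        (W₁ v) (W₁ v)
  have hw₁ : ∀ p, ContDiff 𝕜 ω (fun v => w₁ v p) := fun p => by fun_prop
  have hW₁ : ContDiff 𝕜 ω W₁ := by fun_prop
  have he : ContDiff 𝕜 ω (fun v : (𝕜 × 𝕜 × X) × B' => v.1.1 ^ 2 * v.1.2.1) := by fun_prop
  have hH : ContDiffAt 𝕜 ω H 0 := by
    have h1 : ContDiffAt 𝕜 ω (fun v : (𝕜 × 𝕜 × X) × B' => gr (v.1.1 ^ 2 * v.1.2.1)) 0 :=
      ContDiffAt.comp _ (by simpa using hgr) he.contDiffAt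
    have h2 : ContDiffAt 𝕜 ω (fun v : (𝕜 × 𝕜 × X) × B' => Lr (v.1.1 ^ 2 * v.1.2.1)) 0 :=
      ContDiffAt.comp _ (by simpa using hLr) he.contDiffAt
    have h3 : ContDiffAt 𝕜 ω (fun v : (𝕜 × 𝕜 × X) × B' => q (v.1.1 ^ 2 * v.1.2.1,
        (v.1.1 ^ (2 * k + 1) * v.1.2.1 ^ (k + 1)) • W₁ v)) 0 := by
      refine ContDiffAt.comp (g := q) (0 : (𝕜 × 𝕜 × X) × B') ?_ (he.prodMk (by fun_prop)).contDiffAt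
      simp only [Prod.fst_zero, Prod.snd_zero, ne_eq, OfNat.ofNat_ne_zero, not_false_eq_true,
        zero_pow, mul_zero, Nat.succ_ne_zero, zero_smul]
      exact hq
    have h4 : ContDiffAt 𝕜 ω (fun v => productRem L (k + 1) (v.1.1 ^ 2 * v.1.2.1) (w₁ v)) 0 := by
      refine ContDiffAt.sum fun j _ => ContDiffAt.sum fun p _ => ?_
      have := hw₁ p
      split_ifs
      · exact ContDiff.contDiffAt (by fun_prop)
      · fun_prop
    have h5 := (h3.clm_apply hW₁.contDiffAt).clm_apply hW₁.contDiffAt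
    have h6 := h2.clm_apply hW₁.contDiffAt
    have h7 : ContDiff 𝕜 ω (fun v : (𝕜 × 𝕜 × X) × B' => v.1.1 * v.1.2.1) := by fun_prop
    have h8 : ContDiff 𝕜 ω (fun v : (𝕜 × 𝕜 × X) × B' => v.1.2.1) := by fun_prop
    exact (((contDiffAt_snd.add (he.contDiffAt.smul h1)).add (h7.contDiffAt.smul h4)).add
      (h7.contDiffAt.smul h6)).add (h8.contDiffAt.smul h5)
  have hH0 : ∀ s m y, H ((s, 0, m), y) = y := fun s m y => by simp [H]
  have hQ : ∀ s t m y, s ≠ 0 →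
      H ((s, t, m), y) = y + (s ^ 2 * t) • Q (s ^ 2 * t) (s⁻¹ • m) y := by
    intro s t m y hs
    have e1 : ∀ p, b p + Λ p (y, s⁻¹ • m) = s⁻¹ • w₁ ((s, t, m), y) p := fun p => by
      have : (y, s⁻¹ • m) = s⁻¹ • ((s • y, m) : B' × X) := by
        simp [smul_smul, inv_mul_cancel₀ hs]
      simp only [w₁]
      rw [this, map_smul, smul_add, smul_smul, inv_mul_cancel₀ hs, one_smul]
    have e2 : W (s ^ 2 * t) (s⁻¹ • m) y = s⁻¹ • W₁ ((s, t, m), y) := by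
      simp only [W, W₁, Finset.smul_sum, e1]
      exact Finset.sum_congr rfl fun p _ => smul_comm _ _ _
    have c1 : s ^ 2 * t * s⁻¹ = s * t := by field_simp
    have c2 : (s ^ 2 * t) ^ (k + 1) * s⁻¹ = s ^ (2 * k + 1) * t ^ (k + 1) := by
      field_simp; ring
    have c3 : s ^ 2 * t * (s⁻¹ * s⁻¹) = t := by field_simp
    simp only [H, Q, e2, e1, productRem_smul, map_smul, smul_add, smul_smul, c1, c2, add_assoc,
      FunLike.coe_smul, Pi.smul_apply, c3]
  obtain ⟨y, hy0, hy⟩ := exists_uniform_implicit Q H hH hH0 hQ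
  refine ⟨y, hy0, fun C hC => ?_⟩
  obtain ⟨ε₁, hε₁, hsm, hsol⟩ := hy C hC
  obtain ⟨δ, hδ, hexp⟩ := Metric.eventually_nhds_iff_ball.1 hexp
  let M : ℝ := ∑ p ∈ Finset.range (k + 1), (‖b p‖ + ‖Λ p‖ * max 1 C)
  have hM : 0 ≤ M := Finset.sum_nonneg fun p _ => by positivity
  refine ⟨min ε₁ (min 1 (δ / (M + 1))), by positivity, M, hsm.mono fun q hq =>
    ⟨hq.1.trans_le (min_le_left _ _), hq.2⟩, fun ε n hε hn => ?_⟩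
  obtain ⟨hy1, hy2⟩ := hsol ε n (hε.trans_le (min_le_left _ _)) hn
  have hε1 : ‖ε‖ < 1 := hε.trans_le ((min_le_right _ _).trans (min_le_left _ _))
  have hεδ : ‖ε‖ < δ / (M + 1) := hε.trans_le ((min_le_right _ _).trans (min_le_right _ _))
  have hW : ‖W ε n (y ε n)‖ ≤ M := by
    refine norm_sum_le_of_le _ fun p _ => ?_
    rw [norm_smul, norm_pow]
    have h1 : ‖((y ε n, n) : B' × X)‖ ≤ max 1 C := max_le_max hy1.le hn.le
    calc ‖ε‖ ^ p * ‖b p + Λ p (y ε n, n)‖ ≤ 1 * (‖b p‖ + ‖Λ p‖ * max 1 C) := by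
          gcongr
          · exact pow_le_one₀ (norm_nonneg _) hε1.le
          · exact (norm_add_le _ _).trans (by gcongr; exact (Λ p).le_opNorm_of_le h1)
      _ = _ := one_mul _
  refine ⟨hW, ?_⟩
  have hball : (ε, ε ^ (k + 1) • W ε n (y ε n)) ∈ Metric.ball (0 : 𝕜 × B) δ := by
    rw [lt_div_iff₀ (by positivity)] at hεδ
    simp only [Metric.mem_ball, dist_zero_right, Prod.norm_def, norm_smul, norm_pow]
    have hp : ‖ε‖ ^ (k + 1) ≤ ‖ε‖ :=
      pow_le_of_le_one (norm_nonneg _) hε1.le (Nat.succ_ne_zero k)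
    have hn0 := norm_nonneg ε
    refine max_lt (by nlinarith) ?_
    calc ‖ε‖ ^ (k + 1) * ‖W ε n (y ε n)‖ ≤ ‖ε‖ * M := by gcongr
      _ < δ := by nlinarith
  have h := expansion_along (G := G) (w := fun p => b p + Λ p (y ε n, n)) rfl (hexp _ hball)
  refine h.trans ?_
  have e : ∑ m ∈ Finset.range (2 * k + 2), ε ^ m • residual (𝕜 := 𝕜) G k zb
      (fun p => b p + Λ p (y ε n, n)) m = ε ^ (2 * k + 1) • y ε n := by
    rw [Finset.sum_eq_single (2 * k + 1), hres _ _ _ le_rfl, if_pos rfl]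
    · intro m hm hne
      rw [hres _ _ _ (by have := Finset.mem_range.1 hm; omega), if_neg hne, smul_zero]
    · simp
  rw [e, pow_succ ε (2 * k + 1), mul_smul, ← smul_add]
  change ε ^ (2 * k + 1) • (y ε n + ε • Q ε n (y ε n)) = 0
  rw [hy2, smul_zero]

end Existence

namespace DecompData.IsDecomposition

variable {𝕜 : Type*} [RCLike 𝕜] {B B' : Type*}
  [NormedAddCommGroup B] [NormedSpace 𝕜 B] [NormedAddCommGroup B'] [NormedSpace 𝕜 B']
  {D : DecompData 𝕜 B B'} {G : B → B'} {k : ℕ} {zb : ℕ → B}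

lemma residual_eq [CompleteSpace B'] (hG : AnalyticAt 𝕜 G 0) (hG0 : G 0 = 0)
    (hzb : (Xbar 𝕜 G k zb (2 * k)).Nonempty)
    (hD : D.IsDecomposition (linCoeff 𝕜 G k zb) k)
    (hS : Function.Surjective (D.sumOp (linCoeff 𝕜 G k zb) k)) (y : B') {n : Fin (k + 1) → B}
    (hn : ∀ i : Fin (k + 1), n i ∈ D.N (linCoeff 𝕜 G k zb) (i + 1)) {m : ℕ}
    (hm : m ≤ 2 * k + 1) :
    residual (𝕜 := 𝕜) G k zb (fun p => D.particular (linCoeff 𝕜 G k zb)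
      (fun m => valCoeff 𝕜 G k zb (k + 1 + m)) (k + 1) p + D.liftCurve (linCoeff 𝕜 G k zb) k
        (D.inputOf (linCoeff 𝕜 G k zb) k (y, n)) p) m = if m = 2 * k + 1 then y else 0 := by
  obtain ⟨z, hz, hzk⟩ := hzb
  set w : ℕ → B := fun p => (1 / (Nat.factorial (k + 1 + p) : 𝕜)) • z (k + 1 + p)
  have hw : ∀ m ≤ 2 * k, residual (𝕜 := 𝕜) G k zb w m = 0 := by
    intro m hm
    rcases Nat.eq_zero_or_pos m with rfl | h0
    · simp [residual, valCoeff, curve_zero, hG0]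
    · have h := T_eq_residual hG hzk (show m ≤ 2 * k + 1 by omega)
      rw [hz m (Finset.mem_Icc.2 ⟨h0, hm⟩)] at h
      exact (smul_eq_zero.1 h.symm).resolve_left (by exact_mod_cast Nat.factorial_ne_zero m)
  by_cases hmk : k + 1 ≤ m
  · obtain ⟨i, rfl⟩ := Nat.exists_eq_add_of_le hmk
    rw [residual, if_pos hmk, Nat.add_sub_cancel_left, add_comm]
    rw [hD.cauchyVec_particular_add_liftCurve hS (fun m => valCoeff 𝕜 G k zb (k + 1 + m)) w
      (fun i hi => by
        have := hw (k + 1 + i) (by omega)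
        rwa [residual, if_pos (by omega), Nat.add_sub_cancel_left, add_comm] at this) y hn
      (by omega)]
    exact if_congr (by omega) rfl rfl
  · have := hw m (by omega)
    rw [residual, if_neg hmk] at this ⊢
    rw [this, if_neg (by omega)]

lemma isClosed_N (D : DecompData 𝕜 B B') (L : ℕ → B →L[𝕜] B') (i : ℕ) :
    IsClosed (D.N L i : Set B) := by
  induction i with
  | zero => exact isClosed_univ
  | succ i ih => exact ih.inter (D.S L (i + 1)).isClosed_ker

end DecompData.IsDecomposition

end SolutionCurve

/-! ### The linearization on the complement -/

namespace SolutionCurve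

section DetSmooth

variable {𝕜 : Type*} [RCLike 𝕜] {E : Type*} [NormedAddCommGroup E] [NormedSpace 𝕜 E]

lemma contDiff_det {d : ℕ} {f : E → Matrix (Fin d) (Fin d) 𝕜}
    (hf : ∀ i j, ContDiff 𝕜 ω fun v => f v i j) : ContDiff 𝕜 ω fun v => (f v).det := by
  simp only [Matrix.det_apply']
  exact ContDiff.sum fun σ _ => contDiff_const.mul (contDiff_prod fun i _ => hf _ _)

end DetSmooth

namespace DecompData

variable {𝕜 : Type*} [RCLike 𝕜] {B B' : Type*}
  [NormedAddCommGroup B] [NormedSpace 𝕜 B] [NormedAddCommGroup B'] [NormedSpace 𝕜 B']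
  (D : DecompData 𝕜 B B') (L : ℕ → B →L[𝕜] B') (k : ℕ)

lemma Nc_le_Nctot (i : Fin (k + 1)) : D.Nc (i + 1) ≤ D.Nctot k :=
  le_iSup (fun i : Fin (k + 1) => D.Nc (i + 1)) i

/-- The sum map `N₁ᶜ × … × N_{k+1}ᶜ → Nᶜ`. -/
def sumNc : (∀ i : Fin (k + 1), D.Nc (i + 1)) →ₗ[𝕜] D.Nctot k :=
  ∑ i, (Submodule.inclusion (D.Nc_le_Nctot k i)) ∘ₗ LinearMap.proj i

lemma coe_sumNc (n : ∀ i : Fin (k + 1), D.Nc (i + 1)) : (D.sumNc k n : B) = ∑ i, (n i : B) := by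
  simp [sumNc]

lemma sumNc_surjective : Function.Surjective (D.sumNc k) := by
  rw [← LinearMap.range_eq_top]
  have h : D.Nctot k ≤ (LinearMap.range (D.sumNc k)).map (D.Nctot k).subtype := by
    refine iSup_le fun i x hx => ?_
    refine ⟨D.sumNc k (Pi.single i ⟨x, hx⟩), ⟨_, rfl⟩, ?_⟩
    rw [Submodule.subtype_apply, coe_sumNc, Finset.sum_eq_single i]
    · simp
    · intro j _ hj; simp [Pi.single_eq_of_ne hj]
    · simp
  rw [eq_top_iff]
  rintro ⟨x, hx⟩ -
  obtain ⟨y, hy, hyx⟩ := h hx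
  exact (Subtype.ext hyx : y = ⟨x, hx⟩) ▸ hy

/-- The operator `n ↦ ε^(-i) (∑_{j ≤ k} εʲ L_j + εᵏ Ξ) E_i(ε) n` on `N_i`, written without negative
powers; `v = (ε, Ξ)`. -/
def scaledLin (i : ℕ) (v : 𝕜 × (B →L[𝕜] B')) : B →L[𝕜] B' :=
  D.A L i + ∑ m ∈ Finset.range (k + 1), (if i < m then
      v.1 ^ (m - i) • cauchyCoeff L (D.E L i) m else 0) +
    v.1 ^ (k - i) • (v.1 • (∑ j ∈ Finset.range (k + 1), ∑ p ∈ Finset.range (k + 1),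
      if k + 1 ≤ j + p then v.1 ^ (j + p - (k + 1)) • (L j).comp (D.E L i p) else 0) +
    v.2.comp (∑ p ∈ Finset.range (k + 1), v.1 ^ p • D.E L i p))

lemma contDiff_scaledLin (i : ℕ) : ContDiff 𝕜 ω (D.scaledLin L k i) := by
  unfold scaledLin
  have h1 : ContDiff 𝕜 ω fun v : 𝕜 × (B →L[𝕜] B') => ∑ m ∈ Finset.range (k + 1),
      (if i < m then v.1 ^ (m - i) • cauchyCoeff L (D.E L i) m else 0) := by
    refine ContDiff.sum fun m _ => ?_
    split_ifs <;> fun_prop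
  have h2 : ContDiff 𝕜 ω fun v : 𝕜 × (B →L[𝕜] B') => ∑ j ∈ Finset.range (k + 1),
      ∑ p ∈ Finset.range (k + 1), (if k + 1 ≤ j + p then
        v.1 ^ (j + p - (k + 1)) • (L j).comp (D.E L i p) else 0) := by
    refine ContDiff.sum fun j _ => ContDiff.sum fun p _ => ?_
    split_ifs <;> fun_prop
  have h3 : ContDiff 𝕜 ω fun v : 𝕜 × (B →L[𝕜] B') =>
      v.2.comp (∑ p ∈ Finset.range (k + 1), v.1 ^ p • D.E L i p) :=
    contDiff_snd.clm_comp (by fun_prop)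
  fun_prop

lemma scaledLin_zero {i : ℕ} : D.scaledLin L k i 0 = D.A L i := by
  have : ∑ m ∈ Finset.range (k + 1), (if i < m then
      (0 : 𝕜) ^ (m - i) • cauchyCoeff L (D.E L i) m else 0) = 0 := by
    refine Finset.sum_eq_zero fun m _ => ?_
    split_ifs with h
    · simp [(Nat.sub_pos_of_lt h).ne']
    · rfl
  simp [scaledLin, this]

namespace IsDecomposition

variable {D L} {k : ℕ} (hD : D.IsDecomposition L k)
include hD

lemma sumNc_injective : Function.Injective (D.sumNc k) := by
  rw [injective_iff_map_eq_zero]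
  intro n hn
  have hsum : ∑ i, (n i : B) = 0 := by rw [← coe_sumNc, hn]; rfl
  -- the components vanish one after the other, since `n_j ∈ N_jᶜ ∩ N_j` once the earlier ones do
  have h : ∀ j (hj : j < k + 1), n ⟨j, hj⟩ = 0 := by
    intro j
    induction j using Nat.strong_induction_on with
    | _ j ih =>
    intro hj
    rw [← Finset.add_sum_erase _ _ (Finset.mem_univ (⟨j, hj⟩ : Fin (k + 1)))] at hsum
    have hmem : (n ⟨j, hj⟩ : B) ∈ D.N L (j + 1) := by
      rw [eq_neg_of_add_eq_zero_left hsum]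
      refine (D.N L (j + 1)).neg_mem ((D.N L (j + 1)).sum_mem fun i hi => ?_)
      have hne : (i : ℕ) ≠ j := fun h => (Finset.mem_erase.1 hi).1 (Fin.ext h)
      rcases Nat.lt_or_gt_of_ne hne with h | h
      · rw [show n i = 0 from ih i h i.2]; exact Submodule.zero_mem _
      · exact D.N_anti L h (hD.Nc_le (Nat.lt_succ_iff.1 i.2) (n i).2)
    exact Subtype.ext ((Submodule.disjoint_def.1 (hD.N_disjoint j (by omega))) _
      (n ⟨j, hj⟩).2 hmem)
  funext i
  exact h i i.2

/-- The isomorphism `N₁ᶜ × … × N_{k+1}ᶜ → B'`, `n ↦ ∑ᵢ Aᵢ nᵢ₊₁`. -/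
lemma exists_equiv_sum_A (hS : Function.Surjective (D.sumOp L k)) :
    ∃ T : (∀ i : Fin (k + 1), D.Nc (i + 1)) ≃ₗ[𝕜] B',
      ∀ n, T n = ∑ i : Fin (k + 1), D.A L i (n i) := by
  let f : (∀ i : Fin (k + 1), D.Nc (i + 1)) →ₗ[𝕜] B' :=
    ∑ i : Fin (k + 1), (D.A L i : B →ₗ[𝕜] B') ∘ₗ (D.Nc (i + 1)).subtype ∘ₗ LinearMap.proj i
  have hf : ∀ n, f n = ∑ i : Fin (k + 1), D.A L i (n i) := fun n => by simp [f]
  refine ⟨LinearEquiv.ofBijective f ⟨?_, ?_⟩, hf⟩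
  · rw [injective_iff_map_eq_zero]
    intro n hn
    funext j
    have h := congrArg (D.C L (k + 1) j) (hn ▸ hf n)
    rw [map_zero, map_sum, Finset.sum_eq_single j] at h
    · rw [hD.C_A le_rfl j.2 _ (n j).2, if_pos rfl] at h
      exact Subtype.ext h.symm
    · intro i _ hij
      rw [hD.C_A le_rfl i.2 _ (n i).2, if_neg fun h => hij (Fin.ext h.symm)]
    · simp
  · intro y
    refine ⟨fun i => ⟨D.C L (k + 1) i y, hD.C_mem le_rfl i.2 y⟩, ?_⟩
    rw [hf, Fin.sum_univ_eq_sum_range (fun i => D.A L i (D.C L (k + 1) i y)),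
      hD.sum_A_C le_rfl (hD.P_last_eq_zero hS y)]

lemma lifts_mem_Nctot {j : ℕ} (hj : j ≤ k + 1) :
    (∀ p, ∀ x ∈ D.Nctot k, D.E L j p x ∈ D.Nctot k) ∧ ∀ p y, D.K L j p y ∈ D.Nctot k := by
  induction j with
  | zero =>
    refine ⟨fun p x hx => ?_, fun p y => Submodule.zero_mem _⟩
    by_cases hp : p = 0
    · subst hp; rw [E_zero_zero]; exact hx
    · simp [E, lifts, hp]
  | succ j ih =>
    obtain ⟨ihE, ihK⟩ := ih (by omega)
    refine ⟨fun p x hx => (D.Nctot k).sub_mem (ihE p x hx) (ihK p _), fun p y => ?_⟩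
    cases p with
    | zero => exact Submodule.zero_mem _
    | succ p =>
      have hV : D.V j y ∈ D.Nctot k :=
        D.Nc_le_Nctot k ⟨j, by omega⟩ (hD.V_mem (by omega) y)
      rw [K_succ_succ]
      exact (D.Nctot k).add_mem (ihE p _ hV) (ihK p _)

lemma apply_lift_eq_scaledLin {i : ℕ} (hi : i ≤ k) {x : B} (hx : x ∈ D.N L i)
    (v : 𝕜 × (B →L[𝕜] B')) :
    (∑ j ∈ Finset.range (k + 1), v.1 ^ j • L j + v.1 ^ k • v.2)
      (∑ p ∈ Finset.range (k + 1), v.1 ^ p • D.E L i p x) =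
    v.1 ^ i • D.scaledLin L k i v x := by
  have e0 : v.1 ^ k = v.1 ^ i * v.1 ^ (k - i) := by rw [← pow_add, Nat.add_sub_cancel' hi]
  have e1 : ∑ m ∈ Finset.range (k + 1), v.1 ^ m • cauchyVec L (fun p => D.E L i p x) m =
      v.1 ^ i • (D.A L i x + ∑ m ∈ Finset.range (k + 1), (if i < m then
        v.1 ^ (m - i) • cauchyVec L (fun p => D.E L i p x) m else 0)) := by
    have hmem : i ∈ Finset.range (k + 1) := Finset.mem_range.2 (Nat.lt_succ_iff.2 hi)
    rw [smul_add, Finset.smul_sum, A_apply, ← Finset.add_sum_erase _ _ hmem,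
      ← Finset.add_sum_erase _ (fun m => v.1 ^ i • (if i < m then
        v.1 ^ (m - i) • cauchyVec L (fun p => D.E L i p x) m else 0)) hmem,
      if_neg (lt_irrefl i), smul_zero, zero_add]
    congr 1
    refine Finset.sum_congr rfl fun m hm => ?_
    have hne := (Finset.mem_erase.1 hm).1
    split_ifs with h
    · rw [smul_smul, ← pow_add, Nat.add_sub_cancel' h.le]
    · rw [(hD.cauchyVec_lifts (j := i) (by omega)).1 x hx m (by omega), smul_zero, smul_zero]
  have e2 : ∀ m, cauchyCoeff L (D.E L i) m x = cauchyVec L (fun p => D.E L i p x) m :=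
    fun m => cauchyCoeff_apply L _ m x
  have e3 : D.scaledLin L k i v x = D.A L i x + ∑ m ∈ Finset.range (k + 1), (if i < m then
        v.1 ^ (m - i) • cauchyVec L (fun p => D.E L i p x) m else 0) +
      v.1 ^ (k - i) • (v.1 • productRem L (k + 1) v.1 (fun p => D.E L i p x) +
        v.2 (∑ p ∈ Finset.range (k + 1), v.1 ^ p • D.E L i p x)) := by
    have f1 : ∀ m, (if i < m then v.1 ^ (m - i) • cauchyCoeff L (D.E L i) m else 0) x =
        if i < m then v.1 ^ (m - i) • cauchyVec L (fun p => D.E L i p x) m else 0 := fun m => by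
      split_ifs
      · rw [← e2]; rfl
      · rfl
    have f2 : ∀ j p, (if k + 1 ≤ j + p then
        v.1 ^ (j + p - (k + 1)) • (L j).comp (D.E L i p) else 0) x =
        if k + 1 ≤ j + p then v.1 ^ (j + p - (k + 1)) • L j (D.E L i p x) else 0 := fun j p => by
      split_ifs <;> rfl
    simp only [scaledLin, productRem, add_apply, sum_apply, FunLike.coe_smul, Pi.smul_apply,
      ContinuousLinearMap.comp_apply, f1, f2]
  rw [add_apply, sum_apply]
  simp only [FunLike.coe_smul, Pi.smul_apply]
  rw [sum_pow_smul_apply_sum, e1, e3, pow_succ, e0]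
  simp only [smul_add, smul_smul, mul_assoc]
  abel

end IsDecomposition

end DecompData

end SolutionCurve

/-! ### The determinant -/

namespace SolutionCurve

lemma det_pi_smul {𝕜 ι : Type*} [Field 𝕜] [Fintype ι] {M : ι → Type*}
    [∀ i, AddCommGroup (M i)] [∀ i, Module 𝕜 (M i)] [∀ i, FiniteDimensional 𝕜 (M i)] (a : ι → 𝕜) :
    LinearMap.det (LinearMap.pi fun i => a i • LinearMap.proj i : (∀ i, M i) →ₗ[𝕜] ∀ i, M i) =
      ∏ i, a i ^ Module.finrank 𝕜 (M i) := by
  classical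
  let β := Pi.basis fun i => Module.finBasis 𝕜 (M i)
  rw [← LinearMap.det_toMatrix β]
  have : LinearMap.toMatrix β β (LinearMap.pi fun i => a i • LinearMap.proj i) =
      Matrix.diagonal fun x => a x.1 := by
    ext x x'
    have h : (LinearMap.pi fun i => a i • LinearMap.proj i : (∀ i, M i) →ₗ[𝕜] ∀ i, M i) (β x') =
        a x'.1 • β x' := by
      funext i
      by_cases hi : i = x'.1
      · subst hi; rfl
      · simp [β, Pi.basis_apply, Pi.single_eq_of_ne hi]
    rw [LinearMap.toMatrix_apply, h, map_smul, Module.Basis.repr_self, Matrix.diagonal_apply]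
    by_cases hx : x = x'
    · subst hx; simp
    · simp [hx]
  rw [this, Matrix.det_diagonal, Fintype.prod_sigma]
  simp

namespace DecompData.IsDecomposition

variable {𝕜 : Type*} [RCLike 𝕜] {B B' : Type*}
  [NormedAddCommGroup B] [NormedSpace 𝕜 B] [NormedAddCommGroup B'] [NormedSpace 𝕜 B']
  {D : DecompData 𝕜 B B'} {L : ℕ → B →L[𝕜] B'} {k : ℕ} (hD : D.IsDecomposition L k)
include hD

/-- The determinant on `Nᶜ` of a perturbation `∑_{j ≤ k} εʲ L_j + εᵏ Ξ` of `L(ε)`. With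
`Φ(ε) n = ∑ᵢ E_i(ε) nᵢ₊₁` on `N₁ᶜ × … × N_{k+1}ᶜ` the operator factorizes as
`(∑ εʲ L_j + εᵏ Ξ) Φ(ε) = (A + o(1)) diag(ε⁰, …, εᵏ)`, where `Φ(0)` is the sum map and `A` is
invertible. -/
lemma exists_det_expansion (hS : Function.Surjective (D.sumOp L k))
    [FiniteDimensional 𝕜 (D.Nctot k)] [FiniteDimensional 𝕜 B'] {d : ℕ}
    (b : Module.Basis (Fin d) 𝕜 (D.Nctot k)) (b' : Module.Basis (Fin d) 𝕜 B') :
    ∃ c : 𝕜, c ≠ 0 ∧ ∃ δ : ℝ, 0 < δ ∧ ∃ K : ℝ, 0 ≤ K ∧ ∀ v : 𝕜 × (B →L[𝕜] B'), ‖v‖ < δ →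
      ‖(LinearMap.toMatrix b b'
        (((∑ j ∈ Finset.range (k + 1), v.1 ^ j • L j + v.1 ^ k • v.2 : B →L[𝕜] B') : B →ₗ[𝕜] B') ∘ₗ
          (D.Nctot k).subtype)).det - c * v.1 ^ D.chi k‖ ≤ K * ‖v‖ * ‖v.1‖ ^ D.chi k := by
  classical
  let Z := ∀ i : Fin (k + 1), D.Nc (i + 1)
  let e : Z ≃ₗ[𝕜] D.Nctot k :=
    LinearEquiv.ofBijective (D.sumNc k) ⟨hD.sumNc_injective, D.sumNc_surjective k⟩
  let bZ : Module.Basis (Fin d) 𝕜 Z := b.map e.symm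
  have : FiniteDimensional 𝕜 Z := e.symm.finiteDimensional
  have : ∀ i : Fin (k + 1), FiniteDimensional 𝕜 (D.Nc (i + 1)) := fun i =>
    Submodule.finiteDimensional_of_le (D.Nc_le_Nctot k i)
  obtain ⟨T, hT⟩ := hD.exists_equiv_sum_A hS
  -- the factors `Φ(ε) = ∑ εᵖ Φ_p`, `R(ε, Ξ)` and `diag(εⁱ)`
  let Φ : ℕ → Z →ₗ[𝕜] D.Nctot k := fun p => LinearMap.codRestrict (D.Nctot k)
    (∑ i : Fin (k + 1), (D.E L i p : B →ₗ[𝕜] B) ∘ₗ (D.Nc (i + 1)).subtype ∘ₗ LinearMap.proj i)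
    fun n => by
      rw [LinearMap.sum_apply]
      exact (D.Nctot k).sum_mem fun i _ => (hD.lifts_mem_Nctot (j := i) (by omega)).1 p _
        (D.Nc_le_Nctot k i (n i).2)
  have hΦ : ∀ p n, (Φ p n : B) = ∑ i : Fin (k + 1), D.E L i p (n i) := fun p n => by
    simp [Φ]
    rfl
  let R : 𝕜 × (B →L[𝕜] B') → Z →ₗ[𝕜] B' := fun v =>
    ∑ i : Fin (k + 1), (D.scaledLin L k i v : B →ₗ[𝕜] B') ∘ₗ
      (D.Nc (i + 1)).subtype ∘ₗ LinearMap.proj i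
  have hR : ∀ v n, R v n = ∑ i : Fin (k + 1), D.scaledLin L k i v (n i) := fun v n => by
    simp [R]
    rfl
  let Δ : 𝕜 → Z →ₗ[𝕜] Z := fun ε => LinearMap.pi fun i => ε ^ (i : ℕ) • LinearMap.proj i
  let φ : 𝕜 → 𝕜 := fun ε =>
    (∑ p ∈ Finset.range (k + 1), ε ^ p • LinearMap.toMatrix bZ b (Φ p)).det
  let r : 𝕜 × (B →L[𝕜] B') → 𝕜 := fun v => (LinearMap.toMatrix bZ b' (R v)).det
  have hφs : ContDiff 𝕜 ω φ := contDiff_det fun i j => by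
    simp only [Matrix.sum_apply, Matrix.smul_apply]
    fun_prop
  have hrs : ContDiff 𝕜 ω r := contDiff_det fun i j => by
    have e1 : (fun v => LinearMap.toMatrix bZ b' (R v) i j) = fun v =>
        (LinearMap.toContinuousLinearMap (b'.coord i))
          (∑ l : Fin (k + 1), D.scaledLin L k l v (bZ j l)) := by
      funext v
      rw [LinearMap.toMatrix_apply, hR]
      rfl
    rw [e1]
    refine (LinearMap.toContinuousLinearMap (b'.coord i)).contDiff.comp
      (ContDiff.sum fun l _ => ?_)
    exact (D.contDiff_scaledLin L k l).clm_apply contDiff_const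
  have hφ0 : φ 0 = 1 := by
    have h0 : Φ 0 = e.toLinearMap := by
      refine LinearMap.ext fun n => ?_
      refine Subtype.ext ?_
      rw [hΦ]
      change _ = (D.sumNc k n : B)
      rw [coe_sumNc]
      simp [E_coeff_zero]
    have h1 : LinearMap.toMatrix bZ b (Φ 0) = 1 := by
      ext i j
      rw [LinearMap.toMatrix_apply, h0]
      simp [bZ, Matrix.one_apply, Finsupp.single_apply, eq_comm]
    simp only [φ]
    rw [Finset.sum_eq_single 0]
    · rw [h1]; simp
    · intro p _ hp; simp [hp]
    · simp
  have hr0 : r 0 ≠ 0 := by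
    have h0 : R 0 = T.toLinearMap := by
      refine LinearMap.ext fun n => ?_
      rw [hR]
      simp [hT, scaledLin_zero]
    simp only [r, h0]
    exact (T.isUnit_det bZ b').ne_zero
  have hΔ : ∀ ε, (LinearMap.toMatrix bZ bZ (Δ ε)).det = ε ^ D.chi k := fun ε => by
    rw [LinearMap.det_toMatrix, det_pi_smul, chi, ← Finset.prod_pow_eq_pow_sum,
      ← Fin.prod_univ_eq_prod_range (fun j => ε ^ (j * Module.finrank 𝕜 (D.Nc (j + 1))))]
    exact Finset.prod_congr rfl fun i _ => (pow_mul _ _ _).symm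
  have hfac : ∀ v : 𝕜 × (B →L[𝕜] B'), (LinearMap.toMatrix b b'
      (((∑ j ∈ Finset.range (k + 1), v.1 ^ j • L j + v.1 ^ k • v.2 : B →L[𝕜] B') : B →ₗ[𝕜] B') ∘ₗ
        (D.Nctot k).subtype)).det * φ v.1 = r v * v.1 ^ D.chi k := by
    intro v
    have h1 : ∑ p ∈ Finset.range (k + 1), v.1 ^ p • LinearMap.toMatrix bZ b (Φ p) =
        LinearMap.toMatrix bZ b (∑ p ∈ Finset.range (k + 1), v.1 ^ p • Φ p) := by
      simp
    simp only [φ, r]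
    rw [h1, ← Matrix.det_mul, ← LinearMap.toMatrix_comp, ← hΔ, ← Matrix.det_mul,
      ← LinearMap.toMatrix_comp]
    congr 2
    refine LinearMap.ext fun n => ?_
    have h2 : (((∑ p ∈ Finset.range (k + 1), v.1 ^ p • Φ p) n : D.Nctot k) : B) =
        ∑ i : Fin (k + 1), ∑ p ∈ Finset.range (k + 1), v.1 ^ p • D.E L i p (n i) := by
      rw [Finset.sum_comm]
      simp [LinearMap.sum_apply, hΦ, Finset.smul_sum]
    rw [LinearMap.comp_apply, LinearMap.comp_apply, LinearMap.comp_apply, Submodule.subtype_apply,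
      h2, hR, ContinuousLinearMap.coe_coe, map_sum]
    refine Finset.sum_congr rfl fun i _ => ?_
    have hi : (i : ℕ) ≤ k := Nat.lt_succ_iff.1 i.2
    rw [hD.apply_lift_eq_scaledLin hi (hD.Nc_le hi (n i).2)]
    exact (map_smul (D.scaledLin L k i v) (v.1 ^ (i : ℕ)) (n i : B)).symm
  -- the quotient `r / φ` is differentiable at `0`, hence `r / φ - r 0 / φ 0 = O(v)`
  have hd : DifferentiableAt 𝕜 (fun v : 𝕜 × (B →L[𝕜] B') => r v / φ v.1) 0 := by
    refine ContDiffAt.differentiableAt (n := ω) (ContDiffAt.div hrs.contDiffAt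
      (hφs.comp contDiff_fst).contDiffAt ?_) (by simp)
    simp [hφ0]
  obtain ⟨K, hK, hO⟩ := hd.isBigO_sub.exists_nonneg
  have hne : ∀ᶠ v : 𝕜 × (B →L[𝕜] B') in 𝓝 0, φ v.1 ≠ 0 :=
    (hφs.continuous.comp continuous_fst).continuousAt.eventually_ne (by simp [hφ0])
  obtain ⟨δ, hδ, hv⟩ := Metric.eventually_nhds_iff_ball.1 (hO.bound.and hne)
  refine ⟨r 0, hr0, δ, hδ, K, hK, fun v hvδ => ?_⟩
  obtain ⟨h1, h2⟩ := hv v (by simpa using hvδ)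
  have h3 := eq_div_of_mul_eq h2 (hfac v)
  rw [h3, show r v * v.1 ^ D.chi k / φ v.1 - r 0 * v.1 ^ D.chi k =
    (r v / φ v.1 - r 0) * v.1 ^ D.chi k by ring, norm_mul, norm_pow]
  gcongr
  simpa [hφ0] using h1

end DecompData.IsDecomposition

end SolutionCurve

/-! ### Existence of solution curves -/

namespace SolutionCurve

section Linearization

variable {𝕜 : Type*} [RCLike 𝕜] {B B' : Type*}
  [NormedAddCommGroup B] [NormedSpace 𝕜 B] [NormedAddCommGroup B'] [NormedSpace 𝕜 B']

/-- At points with distance `O(ε^(k+1))` from the curve `z̄(ε)`, the linearization of `G` differs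
from `∑_{j ≤ k} εʲ L_j` by `O(ε^(k+1))` only. -/
lemma exists_fderiv_eq [CompleteSpace B'] {G : B → B'} (hG : AnalyticAt 𝕜 G 0) (k : ℕ)
    (zb : ℕ → B) (M : ℝ) : ∃ δ : ℝ, 0 < δ ∧ ∃ K : ℝ, 0 ≤ K ∧ ∀ (ε : 𝕜) (W : B), ‖ε‖ < δ → ‖W‖ ≤ M →
      ∃ Ξ : B →L[𝕜] B', ‖Ξ‖ ≤ K * ‖ε‖ ∧
        fderiv 𝕜 G (curve 𝕜 k zb ε + ε ^ (k + 1) • W) =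
          ∑ j ∈ Finset.range (k + 1), ε ^ j • linCoeff 𝕜 G k zb j + ε ^ k • Ξ := by
  obtain ⟨gr, Lr, q, -, hLr, -, hlin, -⟩ := exists_expansion hG k zb
  obtain ⟨K, s, hs, hLip⟩ :=
    (hG.fderiv.contDiffAt.hasStrictFDerivAt (n := 1) one_ne_zero).exists_lipschitzOnWith
  obtain ⟨ρ, hρ, hs⟩ := Metric.mem_nhds_iff.1 hs
  have hLrb : ∀ᶠ ε in 𝓝 (0 : 𝕜), ‖Lr ε‖ < ‖Lr 0‖ + 1 :=
    hLr.continuousAt.norm.eventually (gt_mem_nhds (lt_add_one _))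
  have hcurve : ∀ᶠ ε in 𝓝 (0 : 𝕜), curve 𝕜 k zb ε ∈ Metric.ball (0 : B) (ρ / 2) :=
    ((contDiff_curve k zb).continuous.tendsto' 0 0 (curve_zero k zb)).eventually
      (Metric.ball_mem_nhds _ (by positivity))
  obtain ⟨δ, hδ, h⟩ := Metric.eventually_nhds_iff_ball.1 (hlin.and (hLrb.and hcurve))
  refine ⟨min δ (min 1 (ρ / 2 / (|M| + 1))), by positivity, K * |M| + (‖Lr 0‖ + 1), by positivity,
    fun ε W hε hW => ?_⟩
  have hε1 : ‖ε‖ < 1 := hε.trans_le ((min_le_right _ _).trans (min_le_left _ _))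
  have hερ : ‖ε‖ < ρ / 2 / (|M| + 1) := hε.trans_le ((min_le_right _ _).trans (min_le_right _ _))
  obtain ⟨h1, h2, h3⟩ := h ε (by simpa using hε.trans_le (min_le_left _ _))
  have hW' : ‖W‖ ≤ |M| := hW.trans (le_abs_self M)
  have hn : ‖ε ^ (k + 1) • W‖ ≤ ‖ε‖ ^ (k + 1) * |M| := by
    rw [norm_smul, norm_pow]; gcongr
  have hn2 : ‖ε ^ (k + 1) • W‖ < ρ / 2 := by
    rw [lt_div_iff₀ (by positivity)] at hερ
    have hp : ‖ε‖ ^ (k + 1) ≤ ‖ε‖ :=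
      pow_le_of_le_one (norm_nonneg _) hε1.le (Nat.succ_ne_zero k)
    have : ‖ε‖ ^ (k + 1) * |M| ≤ ‖ε‖ * |M| := by gcongr
    nlinarith [norm_nonneg ε]
  rw [Metric.mem_ball, dist_zero_right] at h3
  have hL := hLip.norm_sub_le (x := curve 𝕜 k zb ε + ε ^ (k + 1) • W) (y := curve 𝕜 k zb ε)
    (hs (by
      rw [Metric.mem_ball, dist_zero_right]
      exact (norm_add_le _ _).trans_lt (by linarith)))
    (hs (by rw [Metric.mem_ball, dist_zero_right]; linarith))
  rw [add_sub_cancel_left] at hL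
  rcases eq_or_ne ε 0 with rfl | hε0
  · refine ⟨0, by simp, ?_⟩
    simpa using h1
  · refine ⟨(ε ^ k)⁻¹ • (fderiv 𝕜 G (curve 𝕜 k zb ε + ε ^ (k + 1) • W) -
      ∑ j ∈ Finset.range (k + 1), ε ^ j • linCoeff 𝕜 G k zb j), ?_, ?_⟩
    · rw [norm_smul, norm_inv, norm_pow, inv_mul_le_iff₀ (by positivity)]
      have e : fderiv 𝕜 G (curve 𝕜 k zb ε + ε ^ (k + 1) • W) -
          ∑ j ∈ Finset.range (k + 1), ε ^ j • linCoeff 𝕜 G k zb j =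
          (fderiv 𝕜 G (curve 𝕜 k zb ε + ε ^ (k + 1) • W) - fderiv 𝕜 G (curve 𝕜 k zb ε)) +
            ε ^ (k + 1) • Lr ε := by
        rw [h1]; abel
      rw [e]
      calc _ ≤ ‖fderiv 𝕜 G (curve 𝕜 k zb ε + ε ^ (k + 1) • W) - fderiv 𝕜 G (curve 𝕜 k zb ε)‖ +
            ‖ε ^ (k + 1) • Lr ε‖ := norm_add_le _ _
        _ ≤ K * (‖ε‖ ^ (k + 1) * |M|) + ‖ε‖ ^ (k + 1) * (‖Lr 0‖ + 1) := by
          rw [norm_smul, norm_pow]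
          gcongr
          exact hL.trans (by gcongr)
        _ = ‖ε‖ ^ k * ((K * |M| + (‖Lr 0‖ + 1)) * ‖ε‖) := by ring
    · rw [smul_smul, mul_inv_cancel₀ (pow_ne_zero _ hε0), one_smul, add_sub_cancel]

end Linearization

end SolutionCurve

end

theorem theorem1 {𝕜 : Type*} [RCLike 𝕜] {B B' : Type*}
    [NormedAddCommGroup B] [NormedSpace 𝕜 B] [CompleteSpace B]
    [NormedAddCommGroup B'] [NormedSpace 𝕜 B'] [CompleteSpace B']
    (G : B → B') (hG : AnalyticAt 𝕜 G 0) (hG0 : G 0 = 0)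
    (k : ℕ) (hk : 1 ≤ k) (zb : ℕ → B)
    (hzb : (SolutionCurve.Xbar 𝕜 G k zb (2 * k)).Nonempty)
    (L : ℕ → B →L[𝕜] B') (hL : L = SolutionCurve.linCoeff 𝕜 G k zb)
    (D : SolutionCurve.DecompData 𝕜 B B') (hD : D.IsDecomposition L k)
    (hS : Function.Surjective (D.sumOp L k)) :
    (D.Mhat L k).IsInvertible ∧ (D.Lhat L k).IsInvertible ∧
    ∃ (z : 𝕜 → (∀ i : Fin (k + 1), D.N L (i + 1)) → B)
      (zc : ℕ → 𝕜 → (∀ i : Fin (k + 1), D.N L (i + 1)) → B)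
      (nc : 𝕜 → (∀ i : Fin (k + 1), D.N L (i + 1)) → ∀ i : Fin (k + 1), D.Nc (i + 1)),
      (∀ C : ℝ, 0 < C → ∃ ε₀ : ℝ, 0 < ε₀ ∧
        -- the family is smooth and consists of solution curves
        ContDiffOn 𝕜 ∞ (Function.uncurry z) {q | ‖q.1‖ < ε₀ ∧ ‖q.2‖ < C} ∧
        (∀ m ∈ Finset.Icc (k + 1) (2 * k + 1),
          ContDiffOn 𝕜 ∞ (Function.uncurry (zc m)) {q | ‖q.1‖ < ε₀ ∧ ‖q.2‖ < C}) ∧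
        ContDiffOn 𝕜 ∞ (Function.uncurry nc) {q | ‖q.1‖ < ε₀ ∧ ‖q.2‖ < C} ∧
        ∀ ε n, ‖ε‖ < ε₀ → ‖n‖ < C →
          G (z ε n) = 0 ∧
          -- (i)
          z ε n = SolutionCurve.curve 𝕜 (2 * k + 1)
            (fun m => if m ≤ k then zb m else zc m ε n) ε ∧
          -- (ii)
          (fun m => if m ≤ k then zb m else zc m 0 n) ∈
            SolutionCurve.Xbar 𝕜 G k zb (2 * k + 1) ∧
          (fun m => if m ≤ k then zb m else zc m ε n) ∈
            SolutionCurve.Xbar 𝕜 G k zb (2 * k) ∧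
          -- (iii)
          (fun r : Fin (k + 1) => zc (2 * k + 1 - r) ε n) =
            D.Ihat L (SolutionCurve.valCoeff 𝕜 G k zb) k +
              D.Mhat L k ((fun i => (nc ε n i : B)) + D.Lhat L k (fun i => (n i : B))) ∧
          nc 0 n = 0) ∧
      -- (iv)
      (FiniteDimensional 𝕜 (D.Nctot k) →
        FiniteDimensional 𝕜 B' ∧
        Module.finrank 𝕜 (D.Nctot k) = Module.finrank 𝕜 B' ∧
        ∀ (d : ℕ) (b : Module.Basis (Fin d) 𝕜 (D.Nctot k)) (b' : Module.Basis (Fin d) 𝕜 B'),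
          ∃ c : 𝕜, c ≠ 0 ∧ ∀ C : ℝ, 0 < C → ∃ ε₁ : ℝ, 0 < ε₁ ∧ ∃ K : ℝ, ∀ ε n,
            ‖ε‖ < ε₁ → ‖n‖ < C →
            ‖(LinearMap.toMatrix b b'
                ((fderiv 𝕜 G (z ε n) : B →ₗ[𝕜] B') ∘ₗ (D.Nctot k).subtype)).det
              - c * ε ^ D.chi k‖ ≤ K * ‖ε‖ ^ (D.chi k + 1)) := by
  subst hL
  set L := SolutionCurve.linCoeff 𝕜 G k zb with hL
  refine ⟨D.Mhat_isInvertible L k, D.Lhat_isInvertible L k, ?_⟩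
  have hcomplete : ∀ i : Fin (k + 1), CompleteSpace (D.N L (i + 1)) := fun i =>
    (SolutionCurve.DecompData.IsDecomposition.isClosed_N D L (i + 1)).completeSpace_coe
  -- the coefficients `w_p = z_{k+1+p} / (k+1+p)!` as functions of the residual and of `n`
  let ι : (∀ i : Fin (k + 1), D.N L (i + 1)) →L[𝕜] (Fin (k + 1) → B) :=
    ContinuousLinearMap.pi fun i => (D.N L (i + 1)).subtypeL.comp (ContinuousLinearMap.proj i)
  let b : ℕ → B := D.particular L (fun m => SolutionCurve.valCoeff 𝕜 G k zb (k + 1 + m)) (k + 1)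
  let Λ : ℕ → (B' × (∀ i : Fin (k + 1), D.N L (i + 1))) →L[𝕜] B := fun p =>
    (D.liftCurveL L k p).comp ((D.inputOf L k).comp
      ((ContinuousLinearMap.fst 𝕜 _ _).prod (ι.comp (ContinuousLinearMap.snd 𝕜 _ _))))
  have hΛ : ∀ p y n, Λ p (y, n) = D.liftCurve L k (D.inputOf L k (y, fun i => (n i : B))) p :=
    fun p y n => D.liftCurveL_apply L k p _
  have hres : ∀ y n, ∀ m ≤ 2 * k + 1, SolutionCurve.residual (𝕜 := 𝕜) G k zb
      (fun p => b p + Λ p (y, n)) m = if m = 2 * k + 1 then y else 0 := fun y n m hm => by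
    simp only [hΛ]
    exact SolutionCurve.DecompData.IsDecomposition.residual_eq hG hG0 hzb hD hS y
      (fun i => (n i).2) hm
  obtain ⟨y, hy0, hy⟩ := SolutionCurve.exists_solution_family hG b Λ hres
  let zc : ℕ → 𝕜 → (∀ i : Fin (k + 1), D.N L (i + 1)) → B := fun m ε n =>
    (Nat.factorial m : 𝕜) • (b (m - (k + 1)) + Λ (m - (k + 1)) (y ε n, n))
  let z : 𝕜 → (∀ i : Fin (k + 1), D.N L (i + 1)) → B := fun ε n =>
    SolutionCurve.curve 𝕜 (2 * k + 1) (fun m => if m ≤ k then zb m else zc m ε n) ε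
  let ncL : B' →L[𝕜] ∀ i : Fin (k + 1), D.Nc (i + 1) := ContinuousLinearMap.pi fun i =>
    ((ContinuousLinearMap.proj i).comp (D.ncOf L k)).codRestrict (D.Nc (i + 1))
      fun y => hD.ncOf_mem y i
  have hzc : ∀ ε n p, (1 / (Nat.factorial (k + 1 + p) : 𝕜)) •
      (if k + 1 + p ≤ k then zb (k + 1 + p) else zc (k + 1 + p) ε n) =
        b p + Λ p (y ε n, n) := fun ε n p => by
    have hf : (Nat.factorial (k + 1 + p) : 𝕜) ≠ 0 := by exact_mod_cast Nat.factorial_ne_zero _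
    rw [if_neg (by omega)]
    simp only [zc]
    rw [Nat.add_sub_cancel_left, smul_smul, one_div, inv_mul_cancel₀ hf, one_smul]
  have hz : ∀ ε n, z ε n = SolutionCurve.curve 𝕜 k zb ε + ε ^ (k + 1) •
      ∑ p ∈ Finset.range (k + 1), ε ^ p • (b p + Λ p (y ε n, n)) := fun ε n => by
    simp only [z]
    rw [show 2 * k + 1 = k + (k + 1) by ring, SolutionCurve.curve_add]
    congr 1
    · exact SolutionCurve.curve_congr (fun i hi => if_pos (Finset.mem_Icc.1 hi).2) ε
    · simp only [hzc]
  have hT : ∀ ε n m, m ≤ 2 * k + 1 → SolutionCurve.T 𝕜 G m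
      (fun m => if m ≤ k then zb m else zc m ε n) =
      (Nat.factorial m : 𝕜) • if m = 2 * k + 1 then y ε n else 0 := fun ε n m hm => by
    rw [SolutionCurve.T_eq_residual hG (zb := zb)
      (fun i hi => if_pos (Finset.mem_Icc.1 hi).2) hm]
    simp only [hzc]
    rw [hres _ _ _ hm]
  refine ⟨z, zc, fun ε n => ncL (y ε n), fun C hC => ?_, fun hfin => ?_⟩
  · obtain ⟨ε₀, hε₀, M, hsm, hsol⟩ := hy C hC
    have hw : ∀ p, ContDiffOn 𝕜 ∞ (fun q : 𝕜 × (∀ i : Fin (k + 1), D.N L (i + 1)) =>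
        b p + Λ p (y q.1 q.2, q.2)) {q | ‖q.1‖ < ε₀ ∧ ‖q.2‖ < C} := fun p =>
      contDiffOn_const.add ((Λ p).contDiff.comp_contDiffOn (hsm.prodMk contDiffOn_snd))
    refine ⟨ε₀, hε₀, ?_, fun m _ => ?_, ?_, fun ε n hε hn => ⟨?_, rfl, ⟨?_, ?_⟩, ⟨?_, ?_⟩, ?_, ?_⟩⟩
    · have e : Function.uncurry z = fun q => SolutionCurve.curve 𝕜 k zb q.1 + q.1 ^ (k + 1) •
          ∑ p ∈ Finset.range (k + 1), q.1 ^ p • (b p + Λ p (y q.1 q.2, q.2)) :=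
        funext fun q => hz q.1 q.2
      rw [e]
      refine (((SolutionCurve.contDiff_curve k zb).of_le le_top).comp contDiff_fst).contDiffOn.add
        ((contDiff_fst.pow _).contDiffOn.smul (ContDiffOn.sum fun p _ =>
          (contDiff_fst.pow _).contDiffOn.smul (hw p)))
    · exact contDiffOn_const.smul (hw _)
    · exact ncL.contDiff.comp_contDiffOn hsm
    · rw [hz]; exact (hsol ε n hε hn).2
    · intro m hm
      rw [hT 0 n m (Finset.mem_Icc.1 hm).2, hy0]
      simp
    · intro i hi; exact if_pos (Finset.mem_Icc.1 hi).2
    · intro m hm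
      have hm' := (Finset.mem_Icc.1 hm).2
      rw [hT ε n m (by omega), if_neg (by omega), smul_zero]
    · intro i hi; exact if_pos (Finset.mem_Icc.1 hi).2
    · funext r
      have hr : 2 * k + 1 - (r : ℕ) - (k + 1) = k - r := by omega
      have e : (fun i : Fin (k + 1) => ((ncL (y ε n) i : D.Nc (i + 1)) : B)) + D.Lhat L k (fun i => (n i : B)) =
          D.inputOf L k (y ε n, fun i => (n i : B)) := rfl
      rw [e, Pi.add_apply, D.Mhat_apply]
      simp only [zc, hr, hΛ]
      rw [smul_add]
      rfl
    · simp [hy0]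
  · obtain ⟨T, -⟩ := hD.exists_equiv_sum_A hS
    let e : (∀ i : Fin (k + 1), D.Nc (i + 1)) ≃ₗ[𝕜] D.Nctot k :=
      LinearEquiv.ofBijective (D.sumNc k) ⟨hD.sumNc_injective, D.sumNc_surjective k⟩
    have hfin' : FiniteDimensional 𝕜 B' := (e.symm.trans T).finiteDimensional
    refine ⟨hfin', (e.symm.trans T).finrank_eq, fun d β β' => ?_⟩
    obtain ⟨c, hc, δ, hδ, K, hK, hdet⟩ := hD.exists_det_expansion hS β β'
    refine ⟨c, hc, fun C hC => ?_⟩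
    obtain ⟨ε₀, hε₀, M, -, hsol⟩ := hy C hC
    obtain ⟨δ', hδ', K', hK', hlin⟩ := SolutionCurve.exists_fderiv_eq hG k zb M
    refine ⟨min ε₀ (min δ' (δ / (K' + 1))), by positivity, K * (K' + 1), fun ε n hε hn => ?_⟩
    obtain ⟨Ξ, hΞ, hder⟩ := hlin ε _ (hε.trans_le ((min_le_right _ _).trans (min_le_left _ _)))
      (hsol ε n (hε.trans_le (min_le_left _ _)) hn).1
    have hv : ‖(ε, Ξ)‖ ≤ (K' + 1) * ‖ε‖ := by
      have := norm_nonneg ε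
      exact max_le (by nlinarith) (by nlinarith)
    have hεδ : ‖ε‖ < δ / (K' + 1) :=
      hε.trans_le ((min_le_right _ _).trans (min_le_right _ _))
    rw [lt_div_iff₀ (by positivity)] at hεδ
    have h := hdet (ε, Ξ) (hv.trans_lt (by linarith))
    rw [hz, hder]
    refine h.trans ?_
    calc K * ‖(ε, Ξ)‖ * ‖ε‖ ^ D.chi k ≤ K * ((K' + 1) * ‖ε‖) * ‖ε‖ ^ D.chi k := by gcongr
      _ = K * (K' + 1) * ‖ε‖ ^ (D.chi k + 1) := by ring
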